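/- Finite types are generated from the type $0$ (natural numbers) by forming $\sigma\to\tau$; write $1$ for $0\to 0$ and $2$ for $1\to 0$. The language $\mathsf{L}_\omega$ of higher-order arithmetic has variables of every finite type, application, the constants $0,1,+,\times$, the combinators $\Pi_{\rho,\tau}$, $\Sigma_{\delta,\rho,\tau}$, the recursor $\mathsf{R}_0$, and the relations $=_0$ and $<_0$ between objects of type $0$; equality of higher type is defined by $x=_{\sigma\to\tau}y:\equiv(\forall z^{\sigma})(xz=_{\tau}yz)$. Derivability is derivability in classical many-sorted first-order logic with equality of type $0$. Kohlenbach's base theory $\mathsf{RCA}_0^\omega$ consists of: the basic axioms of arithmetic for $0,1,+,\times,<$; the defining equations $\Pi xy=x$, $\Sigma xyz=xz(yz)$, $\mathsf{R}_0(f,m,0)=m$ and $\mathsf{R}_0(f,m,n+1)=f(n,\mathsf{R}_0(f,m,n))$; the axioms of extensionality $x=_\rho y\rightarrow f(x)=_\tau f(y)$ for all finite types $\rho,\tau$ and all $f$ of type $\rho\to\tau$; induction for quantifier-free formulas; and $\mathsf{QF\text{-}AC}^{1,0}$, i.e. $(\forall x^1)(\exists y^0)A(x,y)\rightarrow(\exists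 Y^2)(\forall x^1)A(x,Y(x))$ for quantifier-free $A$. Parameters of all finite types are allowed in both schemas. The system $\mathsf{ACA}_0^\omega$ is $\mathsf{RCA}_0^\omega$ plus the axiom $$(\exists^2):\quad(\exists\varphi^2\le_2 1)(\forall f^1)\big[(\exists n^0)(f(n)=0)\leftrightarrow\varphi(f)=0\big].$$ In $\mathsf{L}_\omega$, a real number is an object $x$ of type $1$ whose values $x(k)$ code rational numbers with $|x(k)-x(k+i)|\le 2^{-k}$ for all $k,i$; one puts $x\le_{\mathbb R}y$ if $x(k)\le y(k)+2^{-k+1}$ for all $k$, and $x=_{\mathbb R}y$ if $|x(k)-y(k)|\le 2^{-k+1}$ for all $k$. The space $[0,1]$ consists of the real numbers $x$ with $0\le_{\mathbb R}x\le_{\mathbb R}1$; both $[0,1]$ and $\mathbb{R}$ carry the equality $=_{\mathbb R}$. Baire space $\mathbb{N}^{\mathbb N}$ consists of all $f$ of type $1$, and Cantor space $C=2^{\mathbb N}$ of those $f$ of type $1$ with $f(n)\le 1$ for all $n$; both carry the equality $=_1$. For $X$ one of these four spaces with equality $=_X$, let $\mathsf{NIN}^X$ be the sentence of $\mathsf{L}_\omega$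 expressing that there is no injection from $X$ to $\mathbb{N}$: there is no $Y$ of type $2$ such that, for all $x,y\in X$, both $x=_Xy\rightarrow Y(x)=_0Y(y)$ and $Y(x)=_0Y(y)\rightarrow x=_Xy$. Write $\mathsf{NIN}$ for $\mathsf{NIN}^{[0,1]}$. **Theorem.** The system $\mathsf{ACA}_0^\omega$ proves $\mathsf{NIN}\leftrightarrow\mathsf{NIN}^{C}$, $\mathsf{NIN}^{C}\leftrightarrow\mathsf{NIN}^{\mathbb{N}^{\mathbb N}}$ and $\mathsf{NIN}^{\mathbb{N}^{\mathbb N}}\leftrightarrow\mathsf{NIN}^{\mathbb R}$. -/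

import Mathlib

namespace HORM

/-! The language of higher-order arithmetic. -/

/-- Finite types: `o` is the type of natural numbers, `σ ⇒ τ` the type of maps from `σ` to `τ`. -/
inductive Ty : Type
  | o : Ty
  | arr : Ty → Ty → Ty
  deriving DecidableEq

infixr:60 " ⇒ " => Ty.arr

/-- Type `1`: elements of Baire space. -/
abbrev Ty.t1 : Ty := Ty.o ⇒ Ty.o

/-- Type `2`: maps from Baire space to the natural numbers. -/
abbrev Ty.t2 : Ty := Ty.t1 ⇒ Ty.o

open Ty

/-- Terms of finite type. Variables are de Bruijn indices counted separately for each type: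
`var σ n` is bound by the `n`-th enclosing quantifier (from the inside, starting at `0`) among the
quantifiers over the type `σ`, and it is a free variable if there is no such quantifier.
The constants are `0`, `1`, `+`, `×`, the combinators `Π` (`comK`) and `Σ` (`comS`), and the
recursor `R₀` (`recO`) with values of type `o`. -/
inductive Tm : Ty → Type
  | var (σ : Ty) (n : ℕ) : Tm σ
  | zero : Tm o
  | one : Tm o
  | add : Tm (o ⇒ o ⇒ o)
  | mul : Tm (o ⇒ o ⇒ o)
  | comK (ρ τ : Ty) : Tm (ρ ⇒ τ ⇒ ρ)
  | comS (δ ρ τ : Ty) : Tm ((δ ⇒ ρ ⇒ τ) ⇒ (δ ⇒ ρ) ⇒ δ ⇒ τ)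
  | recO : Tm ((o ⇒ o ⇒ o) ⇒ o ⇒ o ⇒ o)
  | app {σ τ : Ty} (f : Tm (σ ⇒ τ)) (a : Tm σ) : Tm τ

infixl:100 " ⬝ " => Tm.app

/-- Formulas. The only primitive relations are `=` and `<` between terms of type `o`. -/
inductive Fml : Type
  | eq (s t : Tm o) : Fml
  | lt (s t : Tm o) : Fml
  | bot : Fml
  | imp (φ ψ : Fml) : Fml
  | all (σ : Ty) (φ : Fml) : Fml

infixr:25 " ⟹ " => Fml.imp

namespace Fml

/-! The remaining connectives, by their classical definitions. -/

def neg (φ : Fml) : Fml := φ ⟹ bot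
def and (φ ψ : Fml) : Fml := neg (φ ⟹ neg ψ)
def or (φ ψ : Fml) : Fml := neg φ ⟹ ψ
def iff (φ ψ : Fml) : Fml := and (φ ⟹ ψ) (ψ ⟹ φ)
def ex (σ : Ty) (φ : Fml) : Fml := neg (all σ (neg φ))

/-- Quantifier-free formulas (free variables of all finite types are allowed). -/
def QF : Fml → Prop
  | eq _ _ => True
  | lt _ _ => True
  | bot => True
  | imp φ ψ => QF φ ∧ QF ψ
  | all _ _ => False

end Fml

/-! Substitution. -/

/-- A simultaneous substitution of terms for all variables. -/
abbrev Sub : Type := (σ : Ty) → ℕ → Tm σ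

namespace Sub

/-- The substitution adding `m` to the indices of the variables of type `σ`. -/
def up (σ : Ty) (m : ℕ) : Sub := fun τ n => Tm.var τ (if τ = σ then n + m else n)

/-- Variable `0` of type `σ` goes to `t`, variable `n + 1` of type `σ` goes to `s σ n`,
and variables of other types go where `s` sends them. -/
def cons {σ : Ty} (t : Tm σ) (s : Sub) : Sub := fun τ n =>
  if h : σ = τ then
    match n with
    | 0 => h ▸ t
    | n + 1 => s τ n
  else s τ n

end Sub

def Tm.subst (s : Sub) : {σ : Ty} → Tm σ → Tm σ
  | _, .var σ n => s σ n
  | _, .zero => .zero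
  | _, .one => .one
  | _, .add => .add
  | _, .mul => .mul
  | _, .comK ρ τ => .comK ρ τ
  | _, .comS δ ρ τ => .comS δ ρ τ
  | _, .recO => .recO
  | _, .app f a => .app (f.subst s) (a.subst s)

/-- Weakening of a term that is put under `m` quantifiers over the type `σ`. -/
def Tm.wk (σ : Ty) (m : ℕ) {τ : Ty} (t : Tm τ) : Tm τ := t.subst (Sub.up σ m)

/-- The substitution that acts as `s` below a quantifier over `σ`. -/
def Sub.lift (σ : Ty) (s : Sub) : Sub := Sub.cons (Tm.var σ 0) fun τ n => (s τ n).wk σ 1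

def Fml.subst : Sub → Fml → Fml
  | s, .eq a b => .eq (a.subst s) (b.subst s)
  | s, .lt a b => .lt (a.subst s) (b.subst s)
  | _, .bot => .bot
  | s, .imp φ ψ => .imp (φ.subst s) (ψ.subst s)
  | s, .all σ φ => .all σ (φ.subst (s.lift σ))

/-- Weakening of a formula that is put under a quantifier over the type `σ`. -/
def Fml.wk (σ : Ty) (φ : Fml) : Fml := φ.subst (Sub.up σ 1)

/-- `φ.inst t` is `φ(t)` for `φ = φ(x)` with `x` the variable `0` of the type of `t`. -/
def Fml.inst {σ : Ty} (φ : Fml) (t : Tm σ) : Fml := φ.subst (Sub.cons t Tm.var)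

/-! Derivations. -/

/-- Natural deduction for classical many-sorted first-order logic with equality of type `o`.
`Prf T Δ φ`: the formula `φ` is derivable from the assumptions `Δ` and from the members of `T`;
the latter may contain free variables and are understood as universally quantified. -/
inductive Prf (T : Set Fml) : List Fml → Fml → Prop
  | theory {Δ φ} : φ ∈ T → Prf T Δ φ
  | hyp {Δ φ} : φ ∈ Δ → Prf T Δ φ
  | impI {Δ φ ψ} : Prf T (φ :: Δ) ψ → Prf T Δ (φ ⟹ ψ)
  | impE {Δ φ ψ} : Prf T Δ (φ ⟹ ψ) → Prf T Δ φ → Prf T Δ ψ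
  | raa {Δ φ} : Prf T (φ.neg :: Δ) .bot → Prf T Δ φ
  | allI {Δ σ φ} : Prf T (Δ.map (Fml.wk σ)) φ → Prf T Δ (.all σ φ)
  | allE {Δ σ φ} (t : Tm σ) : Prf T Δ (.all σ φ) → Prf T Δ (φ.inst t)
  | eqRefl {Δ} (t : Tm o) : Prf T Δ (.eq t t)
  | eqSubst {Δ} (φ : Fml) {s t : Tm o} :
      Prf T Δ (.eq s t) → Prf T Δ (φ.inst s) → Prf T Δ (φ.inst t)

/-- The theory `T` proves `φ`. -/
def Proves (T : Set Fml) (φ : Fml) : Prop := Prf T [] φ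

infix:20 " ⊩ " => Proves

/-! The systems `RCA₀^ω` and `ACA₀^ω`. -/

def plus (s t : Tm o) : Tm o := Tm.add ⬝ s ⬝ t
def times (s t : Tm o) : Tm o := Tm.mul ⬝ s ⬝ t
def suc (s : Tm o) : Tm o := plus s .one

def Fml.le (s t : Tm o) : Fml := .or (.lt s t) (.eq s t)

/-- Equality of higher type: `x =_{σ ⇒ τ} y` is `∀ z^σ, x z =_τ y z`. -/
def eqAt : (σ : Ty) → Tm σ → Tm σ → Fml
  | .o, s, t => .eq s t
  | .arr σ τ, s, t => .all σ (eqAt τ (s.wk σ 1 ⬝ .var σ 0) (t.wk σ 1 ⬝ .var σ 0))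

/-- Kohlenbach's base theory: basic arithmetic, the defining equations of the combinators and of
the recursor, extensionality in all finite types, induction for quantifier-free formulas, and
the choice schema `QF-AC^{1,0}` for quantifier-free formulas. -/
inductive RCA0 : Set Fml
  | suc_ne_zero (s : Tm o) : RCA0 (.neg (.eq (suc s) .zero))
  | suc_inj (s t : Tm o) : RCA0 (.eq (suc s) (suc t) ⟹ .eq s t)
  | add_zero (s : Tm o) : RCA0 (.eq (plus s .zero) s)
  | add_suc (s t : Tm o) : RCA0 (.eq (plus s (suc t)) (suc (plus s t)))
  | mul_zero (s : Tm o) : RCA0 (.eq (times s .zero) .zero)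
  | mul_suc (s t : Tm o) : RCA0 (.eq (times s (suc t)) (plus (times s t) s))
  | not_lt_zero (s : Tm o) : RCA0 (.neg (.lt s .zero))
  | lt_suc (s t : Tm o) : RCA0 (.iff (.lt s (suc t)) (.le s t))
  | comK {ρ τ : Ty} (x : Tm ρ) (y : Tm τ) : RCA0 (eqAt ρ (Tm.comK ρ τ ⬝ x ⬝ y) x)
  | comS {δ ρ τ : Ty} (x : Tm (δ ⇒ ρ ⇒ τ)) (y : Tm (δ ⇒ ρ)) (z : Tm δ) :
      RCA0 (eqAt τ (Tm.comS δ ρ τ ⬝ x ⬝ y ⬝ z) (x ⬝ z ⬝ (y ⬝ z)))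
  | rec_zero (f : Tm (o ⇒ o ⇒ o)) (m : Tm o) : RCA0 (.eq (Tm.recO ⬝ f ⬝ m ⬝ .zero) m)
  | rec_suc (f : Tm (o ⇒ o ⇒ o)) (m n : Tm o) :
      RCA0 (.eq (Tm.recO ⬝ f ⬝ m ⬝ suc n) (f ⬝ n ⬝ (Tm.recO ⬝ f ⬝ m ⬝ n)))
  | extensionality {ρ τ : Ty} (x y : Tm ρ) (f : Tm (ρ ⇒ τ)) :
      RCA0 (eqAt ρ x y ⟹ eqAt τ (f ⬝ x) (f ⬝ y))
  /-- `φ(0) ∧ ∀ n (φ(n) → φ(n + 1)) → ∀ n φ(n)`, where `n` is the variable `0` of type `o`. -/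
  | induction (φ : Fml) : φ.QF →
      RCA0 (φ.inst Tm.zero ⟹
        .all o (φ ⟹ φ.subst (Sub.cons (suc (.var o 0)) (Sub.up o 1))) ⟹ .all o φ)
  /-- `∀ x^1 ∃ y^0 φ(x, y) → ∃ Y^2 ∀ x^1 φ(x, Y(x))`, where `x` and `y` are the variables `0` of
  type `1` and of type `o` in `φ`. -/
  | choice (φ : Fml) : φ.QF →
      RCA0 (.all t1 (.ex o φ) ⟹
        .ex t2 (.all t1 (φ.subst (Sub.cons (Tm.var t2 0 ⬝ Tm.var t1 0) (Sub.up t2 1)))))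

/-- The sentence `(∃²)`:
`∃ Φ^2 ≤ 1, ∀ f^1, (∃ n, f(n) = 0) ↔ Φ(f) = 0`. -/
def existsTwo : Fml :=
  .ex t2 (.and
    (.all t1 (.le (.var t2 0 ⬝ .var t1 0) .one))
    (.all t1 (.iff
      (.ex o (.eq (.var t1 0 ⬝ .var o 0) .zero))
      (.eq (.var t2 0 ⬝ .var t1 0) .zero))))

def ACA0 : Set Fml := insert existsTwo RCA0

/-! Real numbers, coded by fast-converging Cauchy sequences of rational numbers. -/

/-- The identity of type `1`. -/
def idT : Tm t1 := Tm.comS o t1 o ⬝ Tm.comK o t1 ⬝ Tm.comK o o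

/-- The closed term `λ n. 2 ^ n`, by the recursion `2 ^ 0 = 1`, `2 ^ (n + 1) = 2 ^ n + 2 ^ n`. -/
def pow2 : Tm t1 := Tm.recO ⬝ (Tm.comK t1 o ⬝ (Tm.comS o o o ⬝ Tm.add ⬝ idT)) ⬝ .one

/-- The pairing `(s, t) ↦ (s + t)² + s`, which is injective. -/
def pair (s t : Tm o) : Tm o := plus (times (plus s t) (plus s t)) s

/-- The code of the rational number `(a - b) / (d + 1)`. -/
def ratCode (a b d : Tm o) : Tm o := pair (pair a b) d

/-- `p` and `q` are codes of rational numbers with `p ≤ q + e / 2 ^ k`, that is,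
`∃ a b d a₁ b₁ d₁`, `p` codes `(a - b) / (d + 1)`, `q` codes `(a₁ - b₁) / (d₁ + 1)`, and
`2 ^ k (a (d₁ + 1) + b₁ (d + 1)) ≤ 2 ^ k (a₁ (d + 1) + b (d₁ + 1)) + e (d + 1) (d₁ + 1)`. -/
def ratLeAdd (p q e k : Tm o) : Fml :=
  let a : Tm o := .var o 5
  let b : Tm o := .var o 4
  let d : Tm o := .var o 3
  let a₁ : Tm o := .var o 2
  let b₁ : Tm o := .var o 1
  let d₁ : Tm o := .var o 0
  let N : Tm o := pow2 ⬝ k.wk o 6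
  .ex o (.ex o (.ex o (.ex o (.ex o (.ex o
    (.and (.eq (p.wk o 6) (ratCode a b d))
      (.and (.eq (q.wk o 6) (ratCode a₁ b₁ d₁))
        (.le
          (times N (plus (times a (suc d₁)) (times b₁ (suc d))))
          (plus (times N (plus (times a₁ (suc d)) (times b (suc d₁))))
            (times (e.wk o 6) (times (suc d) (suc d₁))))))))))))

/-- `x ∈ ℝ`: all `x(k)` code rational numbers, and `|x(k) - x(k + i)| ≤ 2 ^ (-k)` for all
`k` and `i`. -/
def inReal (x : Tm t1) : Fml :=
  let xk : Tm o := x.wk o 2 ⬝ .var o 1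
  let xki : Tm o := x.wk o 2 ⬝ plus (.var o 1) (.var o 0)
  .all o (.all o (.and (ratLeAdd xk xki .one (.var o 1)) (ratLeAdd xki xk .one (.var o 1))))

/-- `x ≤ y` as real numbers: `x(k) ≤ y(k) + 2 ^ (-k + 1)` for all `k`. -/
def leReal (x y : Tm t1) : Fml :=
  .all o (ratLeAdd (x.wk o 1 ⬝ .var o 0) (y.wk o 1 ⬝ .var o 0) (suc .one) (.var o 0))

/-- `x = y` as real numbers: `|x(k) - y(k)| ≤ 2 ^ (-k + 1)` for all `k`. -/
def eqReal (x y : Tm t1) : Fml := .and (leReal x y) (leReal y x)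

/-- The constant sequences of the rational numbers `0` and `1`. -/
def zeroReal : Tm t1 := Tm.comK o o ⬝ ratCode .zero .zero .zero
def oneReal : Tm t1 := Tm.comK o o ⬝ ratCode .one .zero .zero

/-- `x ∈ [0, 1]`. -/
def inUnit (x : Tm t1) : Fml := .and (inReal x) (.and (leReal zeroReal x) (leReal x oneReal))

/-- `f ∈ 2^ℕ`: `f(n) ≤ 1` for all `n`. -/
def inCantor (f : Tm t1) : Fml := .all o (.le (f.wk o 1 ⬝ .var o 0) .one)

/-- `f ∈ ℕ^ℕ`: no condition. -/
def inBaire (_ : Tm t1) : Fml := .neg .bot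

/-! The uncountability principles. -/

/-- There is no injection to the natural numbers from the space of the objects `x` of type `1`
with `D x`, where `E` is the equality of the space: there is no `Y` of type `2` such that
`E x y → Y(x) = Y(y)` (so that `Y` is a map on the space) and `Y(x) = Y(y) → E x y` (so that it is
injective) for all `x` and `y` with `D x` and `D y`. -/
def noInjection (D : Tm t1 → Fml) (E : Tm t1 → Tm t1 → Fml) : Fml :=
  let Y : Tm t2 := .var t2 0
  let x : Tm t1 := .var t1 1
  let y : Tm t1 := .var t1 0
  .neg (.ex t2 (.and
    (.all t1 (.all t1 (D x ⟹ D y ⟹ E x y ⟹ .eq (Y ⬝ x) (Y ⬝ y))))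
    (.all t1 (.all t1 (D x ⟹ D y ⟹ .eq (Y ⬝ x) (Y ⬝ y) ⟹ E x y)))))

/-- `NIN`: there is no injection from `[0, 1]` to `ℕ`. -/
def NIN : Fml := noInjection inUnit eqReal

/-- There is no injection from Cantor space `2^ℕ` to `ℕ`. -/
def NINCantor : Fml := noInjection inCantor (eqAt t1)

/-- There is no injection from Baire space `ℕ^ℕ` to `ℕ`. -/
def NINBaire : Fml := noInjection inBaire (eqAt t1)

/-- There is no injection from `ℝ` to `ℕ`. -/
def NINReal : Fml := noInjection inReal eqReal

end HORM

/-!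
By the completeness theorem it is enough to prove the equivalences in every model of `ACA₀^ω`; the
models needed are term models of Henkin theories, made extensional by the axioms of extensionality.
In a model the objects of type `0` form an ordered semiring, and injections to it are pulled back
along a cycle of maps.
* A binary sequence `f` is sent to the real number `∑ n, f n / 4 ^ (n + 1)` of the unit interval;
  base 4 leaves gaps, so that distinct sequences give distinct reals.
* A function is sent to the characteristic function of its graph, which exists by `∃²`.
* A real number is sent to the characteristic function of the set of its rational upper bounds;
  this set is arithmetical, so that the function exists by `∃²`, and equal reals have the same one.
* The unit interval is contained in the real line.
-/

namespace HORM

open Ty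

/-! ### Substitution -/

namespace Sub

variable {σ τ : Ty}

@[simp] theorem cons_zero (t : Tm σ) (s : Sub) : cons t s σ 0 = t := by simp [cons]

@[simp] theorem cons_succ (t : Tm σ) (s : Sub) (n : ℕ) : cons t s σ (n + 1) = s σ n := by
  simp [cons]

theorem cons_ne (h : σ ≠ τ) (t : Tm σ) (s : Sub) (n : ℕ) : cons t s τ n = s τ n := by
  simp [cons, h]

@[simp] theorem up_self (m n : ℕ) : up σ m σ n = .var σ (n + m) := by simp [up]

theorem up_ne (h : σ ≠ τ) (m n : ℕ) : up σ m τ n = .var τ n := by simp [up, h.symm]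

/-- Composition of substitutions, in diagrammatic order: first `s`, then `r`. -/
def comp (s r : Sub) : Sub := fun σ n => (s σ n).subst r

theorem ext_cases {s r : Sub} (σ : Ty) (h_zero : s σ 0 = r σ 0)
    (h_succ : ∀ n, s σ (n + 1) = r σ (n + 1)) (h_ne : ∀ τ n, σ ≠ τ → s τ n = r τ n) : s = r := by
  funext τ n
  obtain rfl | h := eq_or_ne σ τ
  · cases n with
    | zero => exact h_zero
    | succ n => exact h_succ n
  · exact h_ne τ n h

theorem up_comp_cons (t : Tm σ) (s : Sub) : (up σ 1).comp (cons t s) = s := by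
  funext τ n
  obtain rfl | h := eq_or_ne σ τ
  · simp [comp, Tm.subst]
  · simp [comp, up_ne h, Tm.subst, cons_ne h]

end Sub

namespace Tm

variable {σ τ ρ : Ty}

theorem subst_subst (s r : Sub) (t : Tm σ) : (t.subst s).subst r = t.subst (s.comp r) := by
  induction t <;> simp_all [Tm.subst, Sub.comp]

@[simp] theorem subst_var (t : Tm σ) : t.subst Tm.var = t := by
  induction t <;> simp_all [Tm.subst]

theorem wk_subst_cons (u : Tm τ) (t : Tm σ) (s : Sub) :
    (u.wk σ 1).subst (Sub.cons t s) = u.subst s := by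
  rw [Tm.wk, subst_subst, Sub.up_comp_cons]

theorem wk_subst_lift (u : Tm τ) (s : Sub) :
    (u.wk σ 1).subst (s.lift σ) = (u.subst s).wk σ 1 := by
  rw [Sub.lift, wk_subst_cons, Tm.wk, subst_subst]
  rfl

theorem wk_wk_comm (u : Tm ρ) : (u.wk σ 1).wk τ 1 = (u.wk τ 1).wk σ 1 := by
  simp only [Tm.wk, subst_subst]
  congr 1
  funext ρ n
  simp only [Sub.comp, Sub.up, Tm.subst]
  split_ifs <;> rfl

end Tm

namespace Sub

variable {σ τ : Ty}

@[simp] theorem lift_zero (s : Sub) : s.lift σ σ 0 = .var σ 0 := by simp [lift]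

@[simp] theorem lift_succ (s : Sub) (n : ℕ) : s.lift σ σ (n + 1) = (s σ n).wk σ 1 := by
  simp [lift]

theorem lift_ne (h : σ ≠ τ) (s : Sub) (n : ℕ) : s.lift σ τ n = (s τ n).wk σ 1 := by
  simp [lift, cons_ne h]

theorem lift_comp_lift (s r : Sub) : (s.lift σ).comp (r.lift σ) = (s.comp r).lift σ := by
  refine ext_cases σ ?_ (fun n => ?_) fun τ n h => ?_
  · simp [comp, Tm.subst]
  · simp [comp, Tm.wk_subst_lift]
  · simp [comp, lift_ne h, Tm.wk_subst_lift]

theorem lift_comp_cons (s r : Sub) (t : Tm σ) :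
    (s.lift σ).comp (cons t r) = cons t (s.comp r) := by
  refine ext_cases σ ?_ (fun n => ?_) fun τ n h => ?_
  · simp [comp, Tm.subst]
  · simp [comp, Tm.wk_subst_cons]
  · simp [comp, lift_ne h, cons_ne h, Tm.wk_subst_cons]

theorem cons_comp (s r : Sub) (t : Tm σ) : (cons t s).comp r = cons (t.subst r) (s.comp r) := by
  refine ext_cases σ ?_ (fun n => ?_) fun τ n h => ?_
  · simp [comp]
  · simp [comp]
  · simp [comp, cons_ne h]

theorem lift_var : Sub.lift σ Tm.var = Tm.var := by
  refine ext_cases σ ?_ (fun n => ?_) fun τ n h => ?_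
  · simp
  · simp [Tm.wk, Tm.subst]
  · simp [lift_ne h, Tm.wk, Tm.subst, up_ne h]

@[simp] theorem comp_var (s : Sub) : s.comp Tm.var = s := by
  funext τ n
  simp [comp]

@[simp] theorem var_comp (s : Sub) : Sub.comp Tm.var s = s := by
  funext τ n
  simp [comp, Tm.subst]

theorem up_comp_lift (s : Sub) : (up σ 1).comp (s.lift σ) = s.comp (up σ 1) :=
  up_comp_cons _ _

theorem lift_comp_up (h : σ ≠ τ) (s : Sub) :
    (s.lift σ).comp (up τ 1) = (s.comp (up τ 1)).lift σ := by
  refine ext_cases σ ?_ (fun n => ?_) fun ρ n hρ => ?_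
  · simp [comp, Tm.subst, up_ne h.symm]
  · rw [comp, lift_succ, lift_succ]
    exact Tm.wk_wk_comm _
  · rw [comp, lift_ne hρ, lift_ne hρ]
    exact Tm.wk_wk_comm _

end Sub

namespace Fml

variable {σ τ : Ty}

theorem subst_subst (φ : Fml) (s r : Sub) : (φ.subst s).subst r = φ.subst (s.comp r) := by
  induction φ generalizing s r with
  | eq a b => simp [Fml.subst, Tm.subst_subst]
  | lt a b => simp [Fml.subst, Tm.subst_subst]
  | bot => rfl
  | imp φ ψ ih₁ ih₂ => simp [Fml.subst, ih₁, ih₂]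
  | all σ φ ih => simp [Fml.subst, ih, Sub.lift_comp_lift]

@[simp] theorem subst_var (φ : Fml) : φ.subst Tm.var = φ := by
  induction φ with
  | eq a b => simp [Fml.subst]
  | lt a b => simp [Fml.subst]
  | bot => rfl
  | imp φ ψ ih₁ ih₂ => simp [Fml.subst, ih₁, ih₂]
  | all σ φ ih => simp [Fml.subst, ih, Sub.lift_var]

theorem subst_lift_inst (φ : Fml) (s : Sub) (t : Tm σ) :
    (φ.subst (s.lift σ)).inst t = φ.subst (Sub.cons t s) := by
  rw [inst, subst_subst, Sub.lift_comp_cons, Sub.comp_var]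

theorem inst_subst (φ : Fml) (s : Sub) (t : Tm σ) :
    (φ.inst t).subst s = (φ.subst (s.lift σ)).inst (t.subst s) := by
  rw [subst_lift_inst, inst, subst_subst, Sub.cons_comp, Sub.var_comp]

theorem wk_subst_lift (φ : Fml) (s : Sub) :
    (φ.wk σ).subst (s.lift σ) = (φ.subst s).wk σ := by
  rw [wk, wk, subst_subst, subst_subst, Sub.up_comp_lift]

theorem QF.subst {φ : Fml} (h : φ.QF) (s : Sub) : (φ.subst s).QF := by
  induction φ generalizing s with
  | imp φ ψ ih₁ ih₂ => exact ⟨ih₁ h.1 s, ih₂ h.2 s⟩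
  | all => exact h.elim
  | _ => trivial

end Fml

/-- A bound on the indices of the variables that occur in a term. -/
def Tm.varBound : {σ : Ty} → Tm σ → ℕ
  | _, .var _ n => n + 1
  | _, .app f a => max f.varBound a.varBound
  | _, _ => 0

/-- A bound on the indices of the free variables of a formula. A bound variable is counted as well,
which does no harm. -/
def Fml.varBound : Fml → ℕ
  | .eq s t | .lt s t => max s.varBound t.varBound
  | .bot => 0
  | .imp φ ψ => max φ.varBound ψ.varBound
  | .all _ φ => φ.varBound

theorem Tm.subst_congr {σ : Ty} (t : Tm σ) {s r : Sub}
    (h : ∀ τ n, n < t.varBound → s τ n = r τ n) : t.subst s = t.subst r := by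
  induction t with
  | var σ n => exact h σ n n.lt_succ_self
  | app f a ihf iha =>
    rw [Tm.subst, Tm.subst, ihf fun τ n hn => h τ n (lt_max_of_lt_left hn),
      iha fun τ n hn => h τ n (lt_max_of_lt_right hn)]
  | _ => rfl

theorem Sub.lift_congr {s r : Sub} {m : ℕ} (h : ∀ τ n, n < m → s τ n = r τ n) (σ τ : Ty) (n : ℕ)
    (hn : n < m) : s.lift σ τ n = r.lift σ τ n := by
  obtain rfl | hσ := eq_or_ne σ τ
  · cases n with
    | zero => simp
    | succ n => simp [h σ n (by omega)]
  · simp [lift_ne hσ, h τ n hn]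

theorem Fml.subst_congr (φ : Fml) {s r : Sub}
    (h : ∀ τ n, n < φ.varBound → s τ n = r τ n) : φ.subst s = φ.subst r := by
  induction φ generalizing s r with
  | eq a b | lt a b =>
    rw [Fml.subst, Fml.subst, a.subst_congr fun τ n hn => h τ n (lt_max_of_lt_left hn),
      b.subst_congr fun τ n hn => h τ n (lt_max_of_lt_right hn)]
  | bot => rfl
  | imp φ ψ ih₁ ih₂ =>
    rw [Fml.subst, Fml.subst, ih₁ fun τ n hn => h τ n (lt_max_of_lt_left hn),
      ih₂ fun τ n hn => h τ n (lt_max_of_lt_right hn)]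
  | all σ φ ih => rw [Fml.subst, Fml.subst, ih (Sub.lift_congr h σ)]

/-- Closure of a set of axioms under substitution; as free variables of axioms are understood as
universally quantified, this costs no generality. -/
def SubstClosed (T : Set Fml) : Prop := ∀ φ ∈ T, ∀ s : Sub, φ.subst s ∈ T

theorem eqAt_subst {σ : Ty} (s t : Tm σ) (r : Sub) :
    (eqAt σ s t).subst r = eqAt σ (s.subst r) (t.subst r) := by
  induction σ generalizing r with
  | o => rfl
  | arr σ τ _ ih => simp [eqAt, Fml.subst, ih, Tm.subst, Tm.wk_subst_lift]

theorem Fml.subst_suc_subst_lift (φ : Fml) (s : Sub) :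
    (φ.subst (Sub.cons (suc (.var o 0)) (Sub.up o 1))).subst (s.lift o) =
      (φ.subst (s.lift o)).subst (Sub.cons (suc (.var o 0)) (Sub.up o 1)) := by
  rw [Fml.subst_subst, Fml.subst_subst, Sub.cons_comp, Sub.lift_comp_cons, Sub.up_comp_lift]
  simp [suc, plus, Tm.subst]

theorem Fml.subst_app_subst_lift (φ : Fml) (s : Sub) :
    (φ.subst (Sub.cons (Tm.var t2 0 ⬝ Tm.var t1 0) (Sub.up t2 1))).subst ((s.lift t2).lift t1) =
      (φ.subst ((s.lift t1).lift o)).subst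
        (Sub.cons (Tm.var t2 0 ⬝ Tm.var t1 0) (Sub.up t2 1)) := by
  have h₁₂ : t1 ≠ t2 := by decide
  have h_up : (Sub.up t2 1).comp ((s.lift t2).lift t1) = (s.lift t1).comp (Sub.up t2 1) := by
    rw [Sub.lift_comp_up h₁₂, ← Sub.up_comp_lift]
    refine Sub.ext_cases t1 ?_ (fun n => ?_) fun τ n h => ?_
    · simp [Sub.comp, Sub.up_ne h₁₂.symm, Tm.subst]
    · simp [Sub.comp, Sub.up_ne h₁₂.symm, Tm.subst]
    · obtain rfl | h' := eq_or_ne t2 τ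
      · simp [Sub.comp, Sub.lift_ne h, Tm.subst]
      · simp [Sub.comp, Sub.up_ne h', Sub.lift_ne h, Sub.lift_ne h', Tm.subst]
  rw [Fml.subst_subst, Fml.subst_subst, Sub.cons_comp, Sub.lift_comp_cons, h_up]
  simp [Tm.subst, Tm.wk, Sub.lift_ne h₁₂, Sub.up_ne h₁₂]

theorem RCA0.substClosed : SubstClosed RCA0 := by
  intro φ h s
  cases h with
  | suc_ne_zero a => exact .suc_ne_zero (a.subst s)
  | suc_inj a b => exact .suc_inj (a.subst s) (b.subst s)
  | add_zero a => exact .add_zero (a.subst s)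
  | add_suc a b => exact .add_suc (a.subst s) (b.subst s)
  | mul_zero a => exact .mul_zero (a.subst s)
  | mul_suc a b => exact .mul_suc (a.subst s) (b.subst s)
  | not_lt_zero a => exact .not_lt_zero (a.subst s)
  | lt_suc a b => exact .lt_suc (a.subst s) (b.subst s)
  | comK x y => exact eqAt_subst _ _ s ▸ .comK (x.subst s) (y.subst s)
  | comS x y z => exact eqAt_subst _ _ s ▸ .comS (x.subst s) (y.subst s) (z.subst s)
  | rec_zero f m => exact .rec_zero (f.subst s) (m.subst s)
  | rec_suc f m n => exact .rec_suc (f.subst s) (m.subst s) (n.subst s)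
  | extensionality x y f =>
    rw [Fml.subst, eqAt_subst, eqAt_subst]
    exact .extensionality (x.subst s) (y.subst s) (f.subst s)
  | induction φ hφ =>
    simp only [Fml.subst, Fml.inst_subst, Fml.subst_suc_subst_lift]
    exact .induction _ (hφ.subst _)
  | choice φ hφ =>
    simp only [Fml.ex, Fml.neg, Fml.subst, Fml.subst_app_subst_lift]
    exact .choice _ (hφ.subst _)

theorem existsTwo_subst (s : Sub) : existsTwo.subst s = existsTwo := by
  have h₁₂ : t1 ≠ t2 := by decide
  have h₀₁ : o ≠ t1 := by decide
  simp [existsTwo, Fml.subst, Fml.ex, Fml.and, Fml.neg, Fml.iff, Fml.le, Fml.or, Tm.subst,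
    Sub.lift_ne h₁₂, Sub.lift_ne h₀₁, Tm.wk, Sub.up_ne h₁₂, Sub.up_ne h₀₁]

theorem ACA0.substClosed : SubstClosed ACA0 := by
  rintro φ (rfl | h) s
  · exact .inl (existsTwo_subst s)
  · exact .inr (RCA0.substClosed φ h s)

/-! ### Derivations -/

namespace Prf

variable {T : Set Fml} {Δ : List Fml} {φ : Fml}

theorem weaken {Δ' : List Fml} (h : Prf T Δ φ) (hΔ : Δ ⊆ Δ') : Prf T Δ' φ := by
  induction h generalizing Δ' with
  | theory h => exact .theory h
  | hyp h => exact .hyp (hΔ h)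
  | impI _ ih => exact .impI (ih (List.cons_subset_cons _ hΔ))
  | impE _ _ ih₁ ih₂ => exact .impE (ih₁ hΔ) (ih₂ hΔ)
  | raa _ ih => exact .raa (ih (List.cons_subset_cons _ hΔ))
  | allI _ ih => exact .allI (ih (List.map_subset _ hΔ))
  | allE t _ ih => exact .allE t (ih hΔ)
  | eqRefl t => exact .eqRefl t
  | eqSubst φ _ _ ih₁ ih₂ => exact .eqSubst φ (ih₁ hΔ) (ih₂ hΔ)

theorem subst (hT : SubstClosed T) (h : Prf T Δ φ) (s : Sub) :
    Prf T (Δ.map (Fml.subst s)) (φ.subst s) := by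
  induction h generalizing s with
  | theory h => exact .theory (hT _ h s)
  | hyp h => exact .hyp (List.mem_map_of_mem h)
  | impI _ ih => exact .impI (ih s)
  | impE _ _ ih₁ ih₂ => exact .impE (ih₁ s) (ih₂ s)
  | raa _ ih => exact .raa (ih s)
  | @allI Δ σ φ _ ih =>
    have h_map : (Δ.map (Fml.wk σ)).map (Fml.subst (s.lift σ)) =
        (Δ.map (Fml.subst s)).map (Fml.wk σ) := by
      simp [Fml.wk_subst_lift]
    exact .allI (h_map ▸ ih (s.lift σ))
  | allE t _ ih => exact Fml.inst_subst _ _ t ▸ .allE _ (ih s)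
  | eqRefl t => exact .eqRefl _
  | eqSubst φ _ _ ih₁ ih₂ =>
    rw [Fml.inst_subst]
    exact .eqSubst _ (ih₁ s) (Fml.inst_subst φ s _ ▸ ih₂ s)

theorem cut {ψ : Fml} (h₁ : Prf T Δ φ) (h₂ : Prf T (φ :: Δ) ψ) : Prf T Δ ψ :=
  .impE (.impI h₂) h₁

theorem exfalso (h : Prf T Δ .bot) (φ : Fml) : Prf T Δ φ :=
  .raa (h.weaken (List.subset_cons_self _ _))

/-- The variable `m` is fresh; it is renamed to the variable bound by the quantifier. -/
theorem all_of_inst_var (hT : SubstClosed T) {σ : Ty} {m : ℕ} (hΔ : ∀ ψ ∈ Δ, ψ.varBound ≤ m)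
    (hφ : φ.varBound ≤ m) (h : Prf T Δ (φ.inst (.var σ m))) : Prf T Δ (.all σ φ) := by
  let r : Sub := fun τ n => if τ = σ ∧ n = m then .var τ 0 else Sub.up σ 1 τ n
  have hr : ∀ τ n, n < m → r τ n = Sub.up σ 1 τ n := fun τ n hn => by simp [r, hn.ne]
  have h_hyps : Δ.map (Fml.subst r) = Δ.map (Fml.wk σ) :=
    List.map_congr_left fun ψ hψ => ψ.subst_congr fun τ n hn => hr τ n (hn.trans_le (hΔ ψ hψ))
  have h_concl : (φ.inst (.var σ m)).subst r = φ := by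
    rw [Fml.inst, Fml.subst_subst]
    refine (φ.subst_congr fun τ n hn => ?_).trans φ.subst_var
    obtain rfl | hτ := eq_or_ne σ τ
    · cases n with
      | zero => simp [Sub.comp, Tm.subst, r]
      | succ n => simp [Sub.comp, Tm.subst, r, show n ≠ m by omega]
    · simp [Sub.comp, Tm.subst, Sub.cons_ne hτ, r, Sub.up_ne hτ, hτ.symm]
  exact .allI (by simpa only [h_hyps, h_concl] using h.subst hT r)

end Prf

/-! ### Countability of the language -/

/-- An injective numbering of the finite types. -/
def Ty.code : Ty → ℕ
  | .o => 0
  | .arr σ τ => Nat.pair σ.code τ.code + 1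

/-- An injective numbering of the terms of all types together. -/
def Tm.code : {σ : Ty} → Tm σ → ℕ
  | _, .var σ n => Nat.pair 0 (Nat.pair σ.code n)
  | _, .zero => Nat.pair 1 0
  | _, .one => Nat.pair 2 0
  | _, .add => Nat.pair 3 0
  | _, .mul => Nat.pair 4 0
  | _, .comK ρ τ => Nat.pair 5 (Nat.pair ρ.code τ.code)
  | _, .comS δ ρ τ => Nat.pair 6 (Nat.pair δ.code (Nat.pair ρ.code τ.code))
  | _, .recO => Nat.pair 7 0
  | _, .app f a => Nat.pair 8 (Nat.pair f.code a.code)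

/-- An injective numbering of the formulas. -/
def Fml.code : Fml → ℕ
  | .eq s t => Nat.pair 0 (Nat.pair s.code t.code)
  | .lt s t => Nat.pair 1 (Nat.pair s.code t.code)
  | .bot => Nat.pair 2 0
  | .imp φ ψ => Nat.pair 3 (Nat.pair φ.code ψ.code)
  | .all σ φ => Nat.pair 4 (Nat.pair σ.code φ.code)

theorem Ty.code_injective : Function.Injective Ty.code := by
  intro σ τ h
  induction σ generalizing τ with
  | o => cases τ <;> simp_all [Ty.code]
  | arr σ₁ σ₂ ih₁ ih₂ =>
    cases τ with
    | o => simp [Ty.code] at h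
    | arr τ₁ τ₂ =>
      obtain ⟨h₁, h₂⟩ : σ₁.code = τ₁.code ∧ σ₂.code = τ₂.code := by simpa [Ty.code] using h
      rw [ih₁ h₁, ih₂ h₂]

theorem Tm.sigma_eq_of_code_eq {σ τ : Ty} {s : Tm σ} {t : Tm τ} (h : s.code = t.code) :
    (⟨σ, s⟩ : Σ σ, Tm σ) = ⟨τ, t⟩ := by
  induction s generalizing τ with
  | app f a ihf iha =>
    cases t with
    | app g b =>
      obtain ⟨hf, ha⟩ : f.code = g.code ∧ a.code = b.code := by simpa [Tm.code] using h
      cases ihf hf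
      cases iha ha
      rfl
    | _ => simp [Tm.code] at h
  | _ => cases t <;> simp [Tm.code, Ty.code_injective.eq_iff] at h ⊢ <;> grind

theorem Tm.code_injective {σ : Ty} : Function.Injective (Tm.code (σ := σ)) := fun _ _ h => by
  cases Tm.sigma_eq_of_code_eq h
  rfl

theorem Fml.code_injective : Function.Injective Fml.code := by
  intro φ ψ h
  induction φ generalizing ψ with
  | imp φ₁ φ₂ ih₁ ih₂ =>
    cases ψ with
    | imp ψ₁ ψ₂ =>
      obtain ⟨h₁, h₂⟩ : φ₁.code = ψ₁.code ∧ φ₂.code = ψ₂.code := by simpa [Fml.code] using h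
      rw [ih₁ h₁, ih₂ h₂]
    | _ => simp [Fml.code] at h
  | all σ φ ih =>
    cases ψ with
    | all τ ψ =>
      obtain ⟨hσ, hφ⟩ : σ = τ ∧ φ.code = ψ.code := by
        simpa [Fml.code, Ty.code_injective.eq_iff] using h
      rw [hσ, ih hφ]
    | _ => simp [Fml.code] at h
  | _ => cases ψ <;> simp_all [Fml.code, Tm.code_injective.eq_iff]

instance : Countable Fml := Fml.code_injective.countable

/-! ### Models -/

/-- Extensional structures for the language: the domain of each finite type is arbitrary, and `=` is
interpreted by equality. -/
structure Model where
  C : Ty → Type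
  app : ∀ {σ τ : Ty}, C (σ ⇒ τ) → C σ → C τ
  ext : ∀ {σ τ : Ty} {f g : C (σ ⇒ τ)}, (∀ x, app f x = app g x) → f = g
  zero : C o
  one : C o
  add : C (o ⇒ o ⇒ o)
  mul : C (o ⇒ o ⇒ o)
  comK : ∀ ρ τ : Ty, C (ρ ⇒ τ ⇒ ρ)
  comS : ∀ δ ρ τ : Ty, C ((δ ⇒ ρ ⇒ τ) ⇒ (δ ⇒ ρ) ⇒ δ ⇒ τ)
  recO : C ((o ⇒ o ⇒ o) ⇒ o ⇒ o ⇒ o)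
  lt : C o → C o → Prop

/-- Assignments of objects to the variables. -/
abbrev Model.Env (M : Model) : Type := (σ : Ty) → ℕ → M.C σ

variable {M : Model}

namespace Model.Env

variable {σ τ : Ty}

/-- The assignment below a quantifier: `x` is the value of the bound variable. -/
def cons (x : M.C σ) (e : M.Env) : M.Env := fun τ n =>
  if h : σ = τ then
    match n with
    | 0 => h ▸ x
    | n + 1 => e τ n
  else e τ n

@[simp] theorem cons_zero (x : M.C σ) (e : M.Env) : cons x e σ 0 = x := by simp [cons]

@[simp] theorem cons_succ (x : M.C σ) (e : M.Env) (n : ℕ) : cons x e σ (n + 1) = e σ n := by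
  simp [cons]

theorem cons_ne (h : σ ≠ τ) (x : M.C σ) (e : M.Env) (n : ℕ) : cons x e τ n = e τ n := by
  simp [cons, h]

end Model.Env

open Model

/-- The value of a term. -/
def Tm.eval (e : M.Env) : {σ : Ty} → Tm σ → M.C σ
  | _, .var σ n => e σ n
  | _, .zero => M.zero
  | _, .one => M.one
  | _, .add => M.add
  | _, .mul => M.mul
  | _, .comK ρ τ => M.comK ρ τ
  | _, .comS δ ρ τ => M.comS δ ρ τ
  | _, .recO => M.recO
  | _, .app f a => M.app (f.eval e) (a.eval e)

/-- Truth of a formula. -/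
def Fml.eval : M.Env → Fml → Prop
  | e, .eq s t => s.eval e = t.eval e
  | e, .lt s t => M.lt (s.eval e) (t.eval e)
  | _, .bot => False
  | e, .imp φ ψ => φ.eval e → ψ.eval e
  | e, .all σ φ => ∀ x : M.C σ, φ.eval (Env.cons x e)

/-- Composition of a substitution with an assignment. -/
def Sub.eval (s : Sub) (e : M.Env) : M.Env := fun τ n => (s τ n).eval e

namespace Sub

variable {σ : Ty}

theorem eval_up (x : M.C σ) (e : M.Env) : (up σ 1).eval (Env.cons x e) = e := by
  funext τ n
  obtain rfl | h := eq_or_ne σ τ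
  · simp [Sub.eval, Tm.eval]
  · simp [Sub.eval, Tm.eval, up_ne h, Env.cons_ne h]

theorem eval_cons (t : Tm σ) (s : Sub) (e : M.Env) :
    (cons t s).eval e = Env.cons (t.eval e) (s.eval e) := by
  funext τ n
  obtain rfl | h := eq_or_ne σ τ
  · cases n <;> simp [Sub.eval]
  · simp [Sub.eval, cons_ne h, Env.cons_ne h]

end Sub

namespace Tm

variable {σ τ : Ty}

theorem eval_subst (s : Sub) (e : M.Env) (t : Tm σ) : (t.subst s).eval e = t.eval (s.eval e) := by
  induction t <;> simp_all [Tm.subst, Tm.eval, Sub.eval]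

@[simp] theorem eval_wk (x : M.C σ) (e : M.Env) (t : Tm τ) :
    (t.wk σ 1).eval (Env.cons x e) = t.eval e := by
  rw [Tm.wk, eval_subst, Sub.eval_up]

theorem wk_add_one (σ : Ty) (m : ℕ) (t : Tm τ) : t.wk σ (m + 1) = (t.wk σ m).wk σ 1 := by
  rw [Tm.wk, Tm.wk, Tm.wk, subst_subst]
  congr 1
  funext τ n
  obtain rfl | h := eq_or_ne σ τ
  · simp [Sub.comp, Tm.subst, add_assoc]
  · simp [Sub.comp, Tm.subst, Sub.up_ne h]

@[simp] theorem eval_wk_add_one (m : ℕ) (x : M.C σ) (e : M.Env) (t : Tm τ) :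
    (t.wk σ (m + 1)).eval (Env.cons x e) = (t.wk σ m).eval e := by
  rw [wk_add_one, eval_wk]

end Tm

theorem Sub.eval_lift {σ : Ty} (s : Sub) (x : M.C σ) (e : M.Env) :
    (s.lift σ).eval (Env.cons x e) = Env.cons x (s.eval e) := by
  rw [Sub.lift, Sub.eval_cons]
  congr 1
  · exact Env.cons_zero x e
  · funext τ n
    exact Tm.eval_wk x e (s τ n)

namespace Fml

variable {σ : Ty} (e : M.Env)

theorem eval_subst (s : Sub) (φ : Fml) : (φ.subst s).eval e ↔ φ.eval (s.eval e) := by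
  induction φ generalizing s e with
  | eq a b => simp [Fml.subst, Fml.eval, Tm.eval_subst]
  | lt a b => simp [Fml.subst, Fml.eval, Tm.eval_subst]
  | bot => rfl
  | imp φ ψ ih₁ ih₂ => simp [Fml.subst, Fml.eval, ih₁, ih₂]
  | all σ φ ih =>
    simp only [Fml.subst, Fml.eval, ih, Sub.eval_lift]

@[simp] theorem eval_wk (x : M.C σ) (φ : Fml) : (φ.wk σ).eval (Env.cons x e) ↔ φ.eval e := by
  rw [Fml.wk, eval_subst, Sub.eval_up]

theorem eval_inst (t : Tm σ) (φ : Fml) : (φ.inst t).eval e ↔ φ.eval (Env.cons (t.eval e) e) := by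
  rw [Fml.inst, eval_subst, Sub.eval_cons]
  rfl

variable (φ ψ : Fml) (s t : Tm o)

@[simp] theorem eval_eq : (Fml.eq s t).eval e ↔ s.eval e = t.eval e := Iff.rfl

@[simp] theorem eval_lt : (Fml.lt s t).eval e ↔ M.lt (s.eval e) (t.eval e) := Iff.rfl

@[simp] theorem eval_bot : Fml.bot.eval e ↔ False := Iff.rfl

@[simp] theorem eval_imp : (φ ⟹ ψ).eval e ↔ (φ.eval e → ψ.eval e) := Iff.rfl

@[simp] theorem eval_all : (Fml.all σ φ).eval e ↔ ∀ x : M.C σ, φ.eval (Env.cons x e) := Iff.rfl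

@[simp] theorem eval_neg : φ.neg.eval e ↔ ¬ φ.eval e := Iff.rfl

@[simp] theorem eval_and : (φ.and ψ).eval e ↔ φ.eval e ∧ ψ.eval e := by simp [Fml.and]

@[simp] theorem eval_or : (φ.or ψ).eval e ↔ φ.eval e ∨ ψ.eval e := by
  simp [Fml.or, or_iff_not_imp_left]

@[simp] theorem eval_iff : (φ.iff ψ).eval e ↔ (φ.eval e ↔ ψ.eval e) := by
  simp [Fml.iff, iff_iff_implies_and_implies]

@[simp] theorem eval_ex : (Fml.ex σ φ).eval e ↔ ∃ x : M.C σ, φ.eval (Env.cons x e) := by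
  simp [Fml.ex]

@[simp] theorem eval_le :
    (Fml.le s t).eval e ↔ M.lt (s.eval e) (t.eval e) ∨ s.eval e = t.eval e := by
  simp [Fml.le]

end Fml

@[simp] theorem eval_eqAt {σ : Ty} (e : M.Env) (s t : Tm σ) :
    (eqAt σ s t).eval e ↔ s.eval e = t.eval e := by
  induction σ generalizing e with
  | o => rfl
  | arr σ τ _ ih =>
    simp only [eqAt, Fml.eval_all, ih, Tm.eval, Tm.eval_wk, Env.cons_zero]
    exact ⟨M.ext, fun h x => by rw [h]⟩

/-- All formulas of `T` are valid in `M`. -/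
def Model.Sat (M : Model) (T : Set Fml) : Prop := ∀ φ ∈ T, ∀ e : M.Env, φ.eval e

/-! ### Completeness -/

/-- Consistency of a finite set of formulas with the theory `T`. -/
def Consistent (T : Set Fml) (Δ : List Fml) : Prop := ¬ Prf T Δ .bot

/-- `Δ` decides `φ`; if it refutes a universal formula, then it also contains a counterexample. -/
def Settles (Δ : List Fml) (φ : Fml) : Prop :=
  φ ∈ Δ ∨ φ.neg ∈ Δ ∧ ∀ σ χ, φ = .all σ χ → ∃ t : Tm σ, (χ.inst t).neg ∈ Δ

theorem Consistent.exists_settles {T : Set Fml} (hT : SubstClosed T) {Δ : List Fml}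
    (h : Consistent T Δ) (φ : Fml) : ∃ Δ', Consistent T Δ' ∧ Δ ⊆ Δ' ∧ Settles Δ' φ := by
  by_cases h_pos : Consistent T (φ :: Δ)
  · exact ⟨φ :: Δ, h_pos, List.subset_cons_self _ _, .inl List.mem_cons_self⟩
  have h_neg : Consistent T (φ.neg :: Δ) := fun hp => h (.cut hp.raa (not_not.1 h_pos))
  by_cases hφ : ∃ σ χ, φ = .all σ χ
  · obtain ⟨σ, χ, rfl⟩ := hφ
    let Δ₁ := (Fml.all σ χ).neg :: Δ
    let m := ((χ :: Δ₁).map Fml.varBound).sum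
    have hm : ∀ ψ ∈ χ :: Δ₁, ψ.varBound ≤ m := fun ψ hψ =>
      List.le_sum_of_mem (List.mem_map_of_mem hψ)
    refine ⟨(χ.inst (.var σ m)).neg :: Δ₁, fun hp => h_neg ?_, by simp [Δ₁],
      .inr ⟨by simp [Δ₁], fun σ' χ' h' => ?_⟩⟩
    · exact .impE (.hyp List.mem_cons_self) (Prf.all_of_inst_var hT
        (fun ψ hψ => hm ψ (List.mem_cons_of_mem _ hψ)) (hm χ List.mem_cons_self) hp.raa)
    · cases h'
      exact ⟨.var σ m, List.mem_cons_self⟩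
  · exact ⟨φ.neg :: Δ, h_neg, List.subset_cons_self _ _,
      .inr ⟨List.mem_cons_self, fun σ χ h' => (hφ ⟨σ, χ, h'⟩).elim⟩⟩

theorem Consistent.exists_chain {T : Set Fml} (hT : SubstClosed T) {Δ : List Fml}
    (h : Consistent T Δ) : ∃ D : ℕ → List Fml, D 0 = Δ ∧ (∀ n, D n ⊆ D (n + 1)) ∧
      (∀ n, Consistent T (D n)) ∧ ∀ φ, ∃ n, Settles (D n) φ := by
  have : Nonempty Fml := ⟨.bot⟩
  obtain ⟨enum, h_enum⟩ := exists_surjective_nat Fml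
  choose next h_cons h_sub h_settles using fun (Γ : {Γ // Consistent T Γ}) (φ : Fml) =>
    Γ.2.exists_settles hT φ
  let D : ℕ → {Γ // Consistent T Γ} := fun n =>
    Nat.rec ⟨Δ, h⟩ (fun k Γ => ⟨next Γ (enum k), h_cons Γ (enum k)⟩) n
  refine ⟨fun n => (D n).1, rfl, fun n => h_sub (D n) (enum n), fun n => (D n).2, fun φ => ?_⟩
  obtain ⟨n, rfl⟩ := h_enum φ
  exact ⟨n + 1, h_settles (D n) (enum n)⟩

/-- Maximal consistent sets with counterexamples to the universal formulas that they refute. -/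
structure Henkin (T : Set Fml) (Γ : Set Fml) : Prop where
  consistent : ∀ {Δ : List Fml}, (∀ ψ ∈ Δ, ψ ∈ Γ) → Consistent T Δ
  mem_or : ∀ φ, φ ∈ Γ ∨ φ.neg ∈ Γ
  witness : ∀ {σ φ}, (Fml.all σ φ) ∈ Γ ∨ ∃ t : Tm σ, (φ.inst t).neg ∈ Γ

theorem Consistent.exists_henkin {T : Set Fml} (hT : SubstClosed T) {Δ : List Fml}
    (h : Consistent T Δ) : ∃ Γ, Henkin T Γ ∧ ∀ φ ∈ Δ, φ ∈ Γ := by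
  classical
  obtain ⟨D, rfl, h_sub, h_cons, h_settles⟩ := h.exists_chain hT
  let D' : ℕ → Set Fml := fun n => {φ | φ ∈ D n}
  have h_mono : Monotone D' := monotone_nat_of_le_succ fun n φ hφ => h_sub n hφ
  refine ⟨⋃ n, D' n, ⟨fun {Δ} hΔ hp => ?_, fun φ => ?_, fun {σ φ} => ?_⟩,
    fun φ hφ => Set.mem_iUnion.2 ⟨0, hφ⟩⟩
  · obtain ⟨n, hn⟩ := h_mono.directed_le.exists_mem_subset_of_finset_subset_biUnion
      (s := Δ.toFinset) fun ψ hψ => hΔ ψ (by simpa using hψ)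
    exact h_cons n (hp.weaken fun ψ hψ => hn (by simpa using hψ))
  · obtain ⟨n, hn⟩ := h_settles φ
    exact hn.imp (fun h' => Set.mem_iUnion.2 ⟨n, h'⟩) fun h' => Set.mem_iUnion.2 ⟨n, h'.1⟩
  · obtain ⟨n, hn⟩ := h_settles (.all σ φ)
    exact hn.imp (fun h' => Set.mem_iUnion.2 ⟨n, h'⟩) fun h' =>
      (h'.2 σ φ rfl).imp fun t ht => Set.mem_iUnion.2 ⟨n, ht⟩

/-- The axioms of extensionality belong to `T`. -/
def Extensional (T : Set Fml) : Prop :=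
  ∀ ⦃ρ τ : Ty⦄ (x y : Tm ρ) (f : Tm (ρ ⇒ τ)), (eqAt ρ x y ⟹ eqAt τ (f ⬝ x) (f ⬝ y)) ∈ T

namespace Henkin

variable {T Γ : Set Fml} (h : Henkin T Γ)
include h

theorem closed {Δ : List Fml} {φ : Fml} (hΔ : ∀ ψ ∈ Δ, ψ ∈ Γ) (hp : Prf T Δ φ) : φ ∈ Γ :=
  (h.mem_or φ).resolve_right fun hφ => h.consistent (Δ := φ.neg :: Δ) (by simpa using ⟨hφ, hΔ⟩)
    (.impE (.hyp List.mem_cons_self) (hp.weaken (List.subset_cons_self _ _)))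

theorem theory {φ : Fml} (hφ : φ ∈ T) : φ ∈ Γ := h.closed (Δ := []) (by simp) (.theory hφ)

theorem bot_notMem : Fml.bot ∉ Γ := fun hb =>
  h.consistent (Δ := [.bot]) (by simpa using hb) (.hyp List.mem_cons_self)

theorem mp {φ ψ : Fml} (h_imp : (φ ⟹ ψ) ∈ Γ) (hφ : φ ∈ Γ) : ψ ∈ Γ :=
  h.closed (Δ := [φ ⟹ ψ, φ]) (by simp [h_imp, hφ])
    (.impE (.hyp (by simp)) (.hyp (by simp) : Prf T _ φ))

theorem imp_mem_iff {φ ψ : Fml} : (φ ⟹ ψ) ∈ Γ ↔ (φ ∈ Γ → ψ ∈ Γ) := by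
  refine ⟨h.mp, fun h' => ?_⟩
  rcases h.mem_or φ with hφ | hφ
  · exact h.closed (Δ := [ψ]) (by simp [h' hφ]) (.impI (.hyp (by simp)))
  · refine h.closed (Δ := [φ.neg]) (by simp [hφ]) (.impI (.exfalso ?_ _))
    exact .impE (φ := φ) (.hyp (List.mem_cons_of_mem _ List.mem_cons_self)) (.hyp (by simp))

theorem all_mem_iff {σ : Ty} {φ : Fml} : Fml.all σ φ ∈ Γ ↔ ∀ t : Tm σ, φ.inst t ∈ Γ := by
  refine ⟨fun h' t => h.closed (Δ := [.all σ φ]) (by simp [h']) (.allE t (.hyp (by simp))),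
    fun h' => h.witness.resolve_right ?_⟩
  rintro ⟨t, ht⟩
  exact h.bot_notMem (h.mp ht (h' t))

theorem eqAt_arr_mem_iff {σ τ : Ty} {s t : Tm (σ ⇒ τ)} :
    eqAt (σ ⇒ τ) s t ∈ Γ ↔ ∀ z : Tm σ, eqAt τ (s ⬝ z) (t ⬝ z) ∈ Γ := by
  simp only [eqAt, h.all_mem_iff, Fml.inst, eqAt_subst, Tm.subst, Tm.wk_subst_cons, Tm.subst_var,
    Sub.cons_zero]

theorem inst_mem_of_eq_mem (φ : Fml) {s t : Tm o} (h_eq : Fml.eq s t ∈ Γ) (hs : φ.inst s ∈ Γ) :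
    φ.inst t ∈ Γ :=
  h.closed (Δ := [.eq s t, φ.inst s]) (by simp [h_eq, hs])
    (.eqSubst (s := s) φ (.hyp (by simp)) (.hyp (by simp)))

theorem eqAt_refl {σ : Ty} (s : Tm σ) : eqAt σ s s ∈ Γ := by
  induction σ with
  | o => exact h.closed (Δ := []) (by simp) (.eqRefl s)
  | arr σ τ _ ih => exact h.eqAt_arr_mem_iff.2 fun z => ih _

theorem eqAt_symm {σ : Ty} {s t : Tm σ} (h_eq : eqAt σ s t ∈ Γ) : eqAt σ t s ∈ Γ := by
  induction σ with
  | o =>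
    have := h.inst_mem_of_eq_mem (.eq (.var o 0) (s.wk o 1)) (s := s) (t := t) h_eq
    simp only [Fml.inst, Fml.subst, Tm.subst, Tm.wk_subst_cons, Tm.subst_var,
      Sub.cons_zero] at this
    exact this (h.eqAt_refl s)
  | arr σ τ _ ih => exact h.eqAt_arr_mem_iff.2 fun z => ih (h.eqAt_arr_mem_iff.1 h_eq z)

theorem eqAt_trans {σ : Ty} {s t u : Tm σ} (h₁ : eqAt σ s t ∈ Γ) (h₂ : eqAt σ t u ∈ Γ) :
    eqAt σ s u ∈ Γ := by
  induction σ with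
  | o =>
    have := h.inst_mem_of_eq_mem (.eq (s.wk o 1) (.var o 0)) (s := t) (t := u) h₂
    simp only [Fml.inst, Fml.subst, Tm.subst, Tm.wk_subst_cons, Tm.subst_var,
      Sub.cons_zero] at this
    exact this h₁
  | arr σ τ _ ih =>
    exact h.eqAt_arr_mem_iff.2 fun z =>
      ih (h.eqAt_arr_mem_iff.1 h₁ z) (h.eqAt_arr_mem_iff.1 h₂ z)

theorem lt_congr {s s' t t' : Tm o} (hs : Fml.eq s s' ∈ Γ) (ht : Fml.eq t t' ∈ Γ)
    (h_lt : Fml.lt s t ∈ Γ) : Fml.lt s' t' ∈ Γ := by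
  have h_left := h.inst_mem_of_eq_mem (.lt (.var o 0) (t.wk o 1)) hs
  have h_right := h.inst_mem_of_eq_mem (.lt (s'.wk o 1) (.var o 0)) ht
  simp only [Fml.inst, Fml.subst, Tm.subst, Tm.wk_subst_cons, Tm.subst_var,
    Sub.cons_zero] at h_left h_right
  exact h_right (h_left h_lt)

theorem app_congr (hT : Extensional T) {σ τ : Ty} {f g : Tm (σ ⇒ τ)} {s t : Tm σ}
    (h_fun : eqAt (σ ⇒ τ) f g ∈ Γ) (h_arg : eqAt σ s t ∈ Γ) : eqAt τ (f ⬝ s) (g ⬝ t) ∈ Γ :=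
  h.eqAt_trans (h.mp (h.theory (hT s t f)) h_arg) (h.eqAt_arr_mem_iff.1 h_fun t)

/-- Equality of terms of type `σ` according to `Γ`. -/
def setoid (σ : Ty) : Setoid (Tm σ) where
  r s t := eqAt σ s t ∈ Γ
  iseqv := ⟨h.eqAt_refl, h.eqAt_symm, h.eqAt_trans⟩

variable (hT : Extensional T)

/-- The term model: its objects are the terms modulo equality according to `Γ`. -/
def model : Model where
  C σ := Quotient (h.setoid σ)
  app := Quotient.map₂ Tm.app fun _ _ h_fun _ _ h_arg => h.app_congr hT h_fun h_arg
  ext {_ _ f g} := Quotient.inductionOn₂ f g fun _ _ h' =>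
    Quotient.sound (h.eqAt_arr_mem_iff.2 fun z => Quotient.exact (h' (Quotient.mk _ z)))
  zero := Quotient.mk _ .zero
  one := Quotient.mk _ .one
  add := Quotient.mk _ .add
  mul := Quotient.mk _ .mul
  comK ρ τ := Quotient.mk _ (.comK ρ τ)
  comS δ ρ τ := Quotient.mk _ (.comS δ ρ τ)
  recO := Quotient.mk _ .recO
  lt := Quotient.lift₂ (fun s t => Fml.lt s t ∈ Γ) fun _ _ _ _ hs ht =>
    propext ⟨h.lt_congr hs ht, h.lt_congr (h.eqAt_symm hs) (h.eqAt_symm ht)⟩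

/-- The object of the term model that is denoted by a term. -/
def den {σ : Ty} (t : Tm σ) : (h.model hT).C σ := Quotient.mk (h.setoid σ) t

/-- The assignment of the term model that belongs to a substitution. -/
def env (s : Sub) : (h.model hT).Env := fun σ n => h.den hT (s σ n)

theorem den_surjective {σ : Ty} : Function.Surjective (h.den hT (σ := σ)) := Quotient.exists_rep

theorem env_surjective : Function.Surjective (h.env hT) := fun e => by
  choose s hs using fun σ n => h.den_surjective hT (e σ n)
  exact ⟨s, funext fun σ => funext fun n => hs σ n⟩

theorem eval_tm (s : Sub) {σ : Ty} (t : Tm σ) : t.eval (h.env hT s) = h.den hT (t.subst s) := by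
  induction t with
  | app f a ihf iha =>
    rw [Tm.eval, ihf, iha]
    rfl
  | _ => rfl

theorem env_cons (s : Sub) {σ : Ty} (t : Tm σ) :
    Env.cons (h.den hT t) (h.env hT s) = h.env hT (Sub.cons t s) := by
  funext τ n
  obtain rfl | hτ := eq_or_ne σ τ
  · cases n <;> simp [env]
  · simp [env, Env.cons_ne hτ, Sub.cons_ne hτ]

theorem eval_fml_iff (s : Sub) (φ : Fml) : φ.eval (h.env hT s) ↔ φ.subst s ∈ Γ := by
  induction φ generalizing s with
  | eq a b =>
    rw [Fml.eval, h.eval_tm, h.eval_tm]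
    exact Quotient.eq
  | lt a b =>
    rw [Fml.eval, h.eval_tm, h.eval_tm]
    rfl
  | bot => exact iff_of_false id h.bot_notMem
  | imp φ ψ ih₁ ih₂ => rw [Fml.eval, ih₁, ih₂, Fml.subst, h.imp_mem_iff]
  | all σ φ ih =>
    rw [Fml.eval, Fml.subst, h.all_mem_iff, (h.den_surjective hT).forall]
    exact forall_congr' fun t => by rw [Fml.subst_lift_inst, ← ih, ← h.env_cons]

theorem sat_model (hs : SubstClosed T) : (h.model hT).Sat T := fun φ hφ =>
  (h.env_surjective hT).forall.2 fun s => (h.eval_fml_iff hT s φ).2 (h.theory (hs φ hφ s))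

end Henkin

theorem proves_of_valid {T : Set Fml} (hT : Extensional T) (hs : SubstClosed T) {φ : Fml}
    (hφ : ∀ M : Model, M.Sat T → ∀ e : M.Env, φ.eval e) : T ⊩ φ := by
  by_contra hp
  have h_cons : Consistent T [φ.neg] := fun h => hp (.raa h)
  obtain ⟨Γ, hΓ, h_neg⟩ := h_cons.exists_henkin hs
  have h_pos := (hΓ.eval_fml_iff hT Tm.var φ).1 (hφ _ (hΓ.sat_model hT hs) _)
  rw [Fml.subst_var] at h_pos
  exact hΓ.bot_notMem (hΓ.mp (h_neg φ.neg List.mem_cons_self) h_pos)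

theorem ACA0.extensional : Extensional ACA0 := fun _ _ x y f => .inr (.extensionality x y f)

theorem ACA0_proves_of_valid {φ : Fml} (hφ : ∀ M : Model, M.Sat ACA0 → ∀ e : M.Env, φ.eval e) :
    ACA0 ⊩ φ :=
  proves_of_valid ACA0.extensional ACA0.substClosed hφ

/-! ### Arithmetic in models -/

namespace Model

instance {σ τ : Ty} : CoeFun (M.C (σ ⇒ τ)) fun _ => M.C σ → M.C τ := ⟨M.app⟩

instance : Zero (M.C o) := ⟨M.zero⟩
instance : One (M.C o) := ⟨M.one⟩
instance : Add (M.C o) := ⟨fun x y => M.add x y⟩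
instance : Mul (M.C o) := ⟨fun x y => M.mul x y⟩
instance : LT (M.C o) := ⟨M.lt⟩

instance instInhabited : (σ : Ty) → Inhabited (M.C σ)
  | .o => ⟨0⟩
  | .arr σ τ => ⟨M.comK τ σ (instInhabited τ).default⟩

section Eval

variable (e : M.Env) (s t : Tm o)

theorem eval_one : Tm.one.eval e = 1 := rfl
theorem eval_plus : (plus s t).eval e = s.eval e + t.eval e := rfl
theorem eval_times : (times s t).eval e = s.eval e * t.eval e := rfl
theorem eval_suc : (suc s).eval e = s.eval e + 1 := rfl

end Eval

section Env

variable {ρ σ τ : Ty} (x : M.C ρ) (y : M.C σ) (z : M.C τ)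

/-- An assignment with given values of the variables `0`, `1` and `2` of given types, which need
not be distinct. -/
def Env.ofTriple : M.Env := fun δ n =>
  match n with
  | 0 => if h : ρ = δ then h ▸ x else default
  | 1 => if h : σ = δ then h ▸ y else default
  | _ => if h : τ = δ then h ▸ z else default

@[simp] theorem Env.ofTriple_zero : Env.ofTriple x y z ρ 0 = x := by simp [Env.ofTriple]
@[simp] theorem Env.ofTriple_one : Env.ofTriple x y z σ 1 = y := by simp [Env.ofTriple]
@[simp] theorem Env.ofTriple_two : Env.ofTriple x y z τ 2 = z := by simp [Env.ofTriple]

end Env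

/-- `M` is a model of `RCA₀^ω`. -/
class IsRCA (M : Model) : Prop where
  sat : M.Sat RCA0

section Axioms

variable [hM : M.IsRCA] {ρ σ τ : Ty} {m n : M.C o}

theorem suc_ne_zero (n : M.C o) : n + 1 ≠ 0 :=
  hM.sat _ (.suc_ne_zero (.var o 0)) (.ofTriple n n n)

theorem suc_inj : m + 1 = n + 1 → m = n :=
  hM.sat _ (.suc_inj (.var o 0) (.var o 1)) (.ofTriple m n n)

protected theorem add_zero (n : M.C o) : n + 0 = n :=
  hM.sat _ (.add_zero (.var o 0)) (.ofTriple n n n)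

theorem add_suc (m n : M.C o) : m + (n + 1) = m + n + 1 :=
  hM.sat _ (.add_suc (.var o 0) (.var o 1)) (.ofTriple m n n)

protected theorem mul_zero (n : M.C o) : n * 0 = 0 :=
  hM.sat _ (.mul_zero (.var o 0)) (.ofTriple n n n)

theorem mul_suc (m n : M.C o) : m * (n + 1) = m * n + m :=
  hM.sat _ (.mul_suc (.var o 0) (.var o 1)) (.ofTriple m n n)

protected theorem not_lt_zero (n : M.C o) : ¬ n < 0 :=
  hM.sat _ (.not_lt_zero (.var o 0)) (.ofTriple n n n)

theorem lt_suc_iff_lt_or_eq : m < n + 1 ↔ m < n ∨ m = n := by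
  have h := hM.sat _ (.lt_suc (.var o 0) (.var o 1)) (.ofTriple m n n)
  rwa [Fml.eval_iff, Fml.eval_le] at h

@[simp] theorem comK_apply (x : M.C ρ) (y : M.C τ) : M.comK ρ τ x y = x := by
  simpa [Tm.eval] using hM.sat _ (.comK (.var ρ 0) (.var τ 1)) (.ofTriple x y y)

@[simp] theorem comS_apply (x : M.C (ρ ⇒ σ ⇒ τ)) (y : M.C (ρ ⇒ σ)) (z : M.C ρ) :
    M.comS ρ σ τ x y z = x z (y z) := by
  simpa [Tm.eval] using
    hM.sat _ (.comS (.var (ρ ⇒ σ ⇒ τ) 0) (.var (ρ ⇒ σ) 1) (.var ρ 2)) (.ofTriple x y z)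

@[simp] theorem recO_zero (f : M.C (o ⇒ o ⇒ o)) (m : M.C o) : M.recO f m 0 = m := by
  simpa [Tm.eval, show M.zero = 0 from rfl] using
    hM.sat _ (.rec_zero (.var _ 0) (.var _ 1)) (.ofTriple f m m)

@[simp] theorem recO_suc (f : M.C (o ⇒ o ⇒ o)) (m n : M.C o) :
    M.recO f m (n + 1) = f n (M.recO f m n) := by
  simpa [Tm.eval, eval_suc] using
    hM.sat _ (.rec_suc (.var _ 0) (.var _ 1) (.var _ 2)) (.ofTriple f m n)

theorem eval_induction {φ : Fml} (hφ : φ.QF) (e : M.Env) (zero : φ.eval (Env.cons (0 : M.C o) e))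
    (succ : ∀ n : M.C o, φ.eval (Env.cons n e) → φ.eval (Env.cons (n + 1) e)) (n : M.C o) :
    φ.eval (Env.cons n e) := by
  refine hM.sat _ (.induction φ hφ) e ((Fml.eval_inst e _ φ).2 zero) (fun n hn => ?_) n
  rw [Fml.eval_subst, Sub.eval_cons, Sub.eval_up, eval_suc]
  simpa [Tm.eval] using succ n hn

end Axioms

/-- The function `f` is represented by an object of the model. -/
@[fun_prop]
def Rep {σ τ : Ty} (f : M.C σ → M.C τ) : Prop := ∃ F : M.C (σ ⇒ τ), ∀ x, F x = f x

namespace Rep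

variable [M.IsRCA] {ρ σ τ : Ty}

@[fun_prop]
theorem id : Rep fun x : M.C σ => x :=
  ⟨M.comS σ (o ⇒ σ) σ (M.comK σ (o ⇒ σ)) (M.comK σ o), by simp⟩

@[fun_prop]
theorem const (y : M.C τ) : Rep fun _ : M.C σ => y := ⟨M.comK τ σ y, by simp⟩

@[fun_prop]
theorem app {f : M.C ρ → M.C (σ ⇒ τ)} {g : M.C ρ → M.C σ} (hf : Rep f) (hg : Rep g) :
    Rep fun x => f x (g x) := by
  obtain ⟨F, hF⟩ := hf
  obtain ⟨G, hG⟩ := hg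
  exact ⟨M.comS ρ σ τ F G, fun x => by simp [hF, hG]⟩

variable {f g : M.C σ → M.C o}

@[fun_prop]
theorem add (hf : Rep f) (hg : Rep g) : Rep fun x => f x + g x := app (app (const M.add) hf) hg

@[fun_prop]
theorem mul (hf : Rep f) (hg : Rep g) : Rep fun x => f x * g x := app (app (const M.mul) hf) hg

end Rep

/-- The predicate `P` is given by a quantifier-free formula with parameters. -/
@[fun_prop]
def QFPred (P : M.C o → Prop) : Prop :=
  ∃ φ : Fml, φ.QF ∧ ∃ e : M.Env, ∀ n, P n ↔ φ.eval (Env.cons n e)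

namespace QFPred

variable {f g : M.C o → M.C o} {P Q : M.C o → Prop}

@[fun_prop]
theorem eq (hf : Rep f) (hg : Rep g) : QFPred fun n => f n = g n := by
  obtain ⟨F, hF⟩ := hf
  obtain ⟨G, hG⟩ := hg
  refine ⟨.eq (.var t1 0 ⬝ .var o 0) (.var t1 1 ⬝ .var o 0), trivial,
    Env.cons F (Env.cons G default), fun n => ?_⟩
  simp [Tm.eval, Env.cons_ne, hF, hG]

@[fun_prop]
theorem lt (hf : Rep f) (hg : Rep g) : QFPred fun n => f n < g n := by
  obtain ⟨F, hF⟩ := hf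
  obtain ⟨G, hG⟩ := hg
  refine ⟨.lt (.var t1 0 ⬝ .var o 0) (.var t1 1 ⬝ .var o 0), trivial,
    Env.cons F (Env.cons G default), fun n => ?_⟩
  simp only [Fml.eval_lt, Tm.eval, Env.cons_zero, ne_eq, reduceCtorEq, not_false_eq_true,
    Env.cons_ne, Env.cons_succ, hF, hG]
  rfl

@[fun_prop]
theorem const (p : Prop) : QFPred fun _ : M.C o => p := by
  by_cases h : p
  · exact ⟨.imp .bot .bot, ⟨trivial, trivial⟩, default, fun n => by simp [h]⟩
  · exact ⟨.bot, trivial, default, fun n => by simp [h]⟩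

/-- The parameters of the two formulas are interleaved. -/
theorem imp (hP : QFPred P) (hQ : QFPred Q) : QFPred fun n => P n → Q n := by
  obtain ⟨φ, hφ, e, he⟩ := hP
  obtain ⟨ψ, hψ, d, hd⟩ := hQ
  let double (i : ℕ) : Sub := fun σ n => .var σ (2 * n + i)
  let env : M.Env := fun σ n => if n % 2 = 0 then e σ (n / 2) else d σ (n / 2)
  have h_even : (double 0).eval env = e := by
    funext σ n
    simp [Sub.eval, double, Tm.eval, env]
  have h_odd : (double 1).eval env = d := by
    funext σ n
    simp [Sub.eval, double, Tm.eval, env, Nat.add_mod, Nat.mul_add_div]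
  refine ⟨φ.subst ((double 0).lift o) ⟹ ψ.subst ((double 1).lift o), ⟨hφ.subst _, hψ.subst _⟩,
    env, fun n => ?_⟩
  change (P n → Q n) ↔ _
  rw [he, hd, Fml.eval_imp, Fml.eval_subst, Fml.eval_subst, Sub.eval_lift, Sub.eval_lift, h_even,
    h_odd]

@[fun_prop]
theorem not (hP : QFPred P) : QFPred fun n => ¬ P n := hP.imp (const False)

@[fun_prop]
theorem or (hP : QFPred P) (hQ : QFPred Q) : QFPred fun n => P n ∨ Q n := by
  simpa only [← or_iff_not_imp_left] using hP.not.imp hQ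

end QFPred

theorem qfInduction [M.IsRCA] {P : M.C o → Prop} (qf : QFPred P) (zero : P 0)
    (succ : ∀ n, P n → P (n + 1)) (n : M.C o) : P n := by
  obtain ⟨φ, hφ, e, he⟩ := qf
  simp only [he] at *
  exact eval_induction hφ e zero succ n

variable [M.IsRCA]

protected theorem zero_add (n : M.C o) : 0 + n = n := by
  induction n using qfInduction with
  | qf => fun_prop
  | zero => exact Model.add_zero 0
  | succ n h => rw [add_suc, h]

theorem suc_add (m n : M.C o) : m + 1 + n = m + n + 1 := by
  induction n using qfInduction with
  | qf => fun_prop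
  | zero => rw [Model.add_zero, Model.add_zero]
  | succ n h => rw [add_suc, h, add_suc]

protected theorem add_comm (m n : M.C o) : m + n = n + m := by
  induction n using qfInduction with
  | qf => fun_prop
  | zero => rw [Model.add_zero, Model.zero_add]
  | succ n h => rw [add_suc, h, suc_add]

protected theorem add_assoc (k m n : M.C o) : k + m + n = k + (m + n) := by
  induction n using qfInduction with
  | qf => fun_prop
  | zero => rw [Model.add_zero, Model.add_zero]
  | succ n h => rw [add_suc, h, add_suc, add_suc]

instance : AddCommMonoid (M.C o) where
  add_assoc := Model.add_assoc
  zero_add := Model.zero_add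
  add_zero := Model.add_zero
  add_comm := Model.add_comm
  nsmul := nsmulRec

protected theorem zero_mul (n : M.C o) : 0 * n = 0 := by
  induction n using qfInduction with
  | qf => fun_prop
  | zero => exact Model.mul_zero 0
  | succ n h => rw [mul_suc, h, add_zero]

theorem suc_mul (m n : M.C o) : (m + 1) * n = m * n + n := by
  induction n using qfInduction with
  | qf => fun_prop
  | zero => rw [Model.mul_zero, Model.mul_zero, add_zero]
  | succ n h =>
    rw [mul_suc, h, mul_suc]
    abel

protected theorem mul_comm (m n : M.C o) : m * n = n * m := by
  induction n using qfInduction with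
  | qf => fun_prop
  | zero => rw [Model.mul_zero, Model.zero_mul]
  | succ n h => rw [mul_suc, h, suc_mul]

protected theorem mul_add (k m n : M.C o) : k * (m + n) = k * m + k * n := by
  induction k using qfInduction with
  | qf => fun_prop
  | zero => rw [Model.zero_mul, Model.zero_mul, Model.zero_mul, add_zero]
  | succ k h =>
    rw [suc_mul, suc_mul, suc_mul, h]
    abel

protected theorem mul_assoc (k m n : M.C o) : k * m * n = k * (m * n) := by
  induction n using qfInduction with
  | qf => fun_prop
  | zero => rw [Model.mul_zero, Model.mul_zero, Model.mul_zero]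
  | succ n h => rw [mul_suc, h, mul_suc, Model.mul_add]

protected theorem mul_one (n : M.C o) : n * 1 = n := by
  rw [← zero_add 1, mul_suc, Model.mul_zero, zero_add]

instance : CommSemiring (M.C o) where
  left_distrib := Model.mul_add
  right_distrib k m n := by simp only [Model.mul_comm _ n, Model.mul_add]
  zero_mul := Model.zero_mul
  mul_zero := Model.mul_zero
  mul_assoc := Model.mul_assoc
  one_mul n := by rw [Model.mul_comm, Model.mul_one]
  mul_one := Model.mul_one
  mul_comm := Model.mul_comm

variable (M) in
/-- The predecessor; it maps `0` to `0`. -/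
def pred : M.C t1 := M.recO (M.comK o o) 0

@[simp] theorem pred_zero : M.pred 0 = 0 := recO_zero _ _

@[simp] theorem pred_suc (n : M.C o) : M.pred (n + 1) = n := by simp [pred]

theorem eq_zero_or_exists_eq_suc (n : M.C o) : n = 0 ∨ ∃ m, n = m + 1 := by
  suffices n = 0 ∨ n = M.pred n + 1 from this.imp_right fun h => ⟨_, h⟩
  induction n using qfInduction with
  | qf => fun_prop
  | zero => exact .inl rfl
  | succ n _ => exact .inr (by rw [pred_suc])

protected theorem lt_trans {k m n : M.C o} (h : k < m) : m < n → k < n := by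
  induction n using qfInduction with
  | qf => exact .imp (by fun_prop) (by fun_prop)
  | zero => exact fun h' => (Model.not_lt_zero m h').elim
  | succ n ih =>
    intro h'
    obtain h' | rfl := lt_suc_iff_lt_or_eq.1 h'
    · exact lt_suc_iff_lt_or_eq.2 (.inl (ih h'))
    · exact lt_suc_iff_lt_or_eq.2 (.inl h)

theorem lt_suc_self (n : M.C o) : n < n + 1 := lt_suc_iff_lt_or_eq.2 (.inr rfl)

protected theorem lt_irrefl (n : M.C o) : ¬ n < n := by
  induction n using qfInduction with
  | qf => fun_prop
  | zero => exact Model.not_lt_zero 0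
  | succ n ih =>
    intro h
    obtain h | h := lt_suc_iff_lt_or_eq.1 h
    · exact ih (Model.lt_trans (lt_suc_self n) h)
    · exact ih ((lt_suc_self n).trans_eq h)

theorem suc_lt_suc {m n : M.C o} : m < n → m + 1 < n + 1 := by
  induction n using qfInduction with
  | qf => exact .imp (by fun_prop) (by fun_prop)
  | zero => exact fun h => (Model.not_lt_zero m h).elim
  | succ n ih =>
    intro h
    obtain h | rfl := lt_suc_iff_lt_or_eq.1 h
    · exact Model.lt_trans (ih h) (lt_suc_self (n + 1))
    · exact lt_suc_self (m + 1)

theorem suc_pos (n : M.C o) : 0 < n + 1 := by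
  induction n using qfInduction with
  | qf => fun_prop
  | zero => exact lt_suc_iff_lt_or_eq.2 (.inr rfl)
  | succ n ih => exact lt_suc_iff_lt_or_eq.2 (.inl ih)

protected theorem lt_trichotomy (m n : M.C o) : m < n ∨ m = n ∨ n < m := by
  induction n using qfInduction with
  | qf => fun_prop
  | zero =>
    obtain rfl | ⟨k, rfl⟩ := eq_zero_or_exists_eq_suc m
    · exact .inr (.inl rfl)
    · exact .inr (.inr (suc_pos k))
  | succ n ih =>
    obtain h | rfl | h := ih
    · exact .inl (lt_suc_iff_lt_or_eq.2 (.inl h))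
    · exact .inl (lt_suc_self m)
    · obtain rfl | ⟨k, rfl⟩ := eq_zero_or_exists_eq_suc m
      · exact (Model.not_lt_zero n h).elim
      · obtain h | rfl := lt_suc_iff_lt_or_eq.1 h
        · exact .inr (.inr (suc_lt_suc h))
        · exact .inr (.inl rfl)

instance : IsStrictTotalOrder (M.C o) (· < ·) where
  trichotomous m n h h' := ((Model.lt_trichotomy m n).resolve_left h).resolve_right h'
  irrefl := Model.lt_irrefl
  trans _ _ _ := Model.lt_trans

noncomputable instance : LinearOrder (M.C o) :=
  haveI := Classical.decRel ((· < ·) : M.C o → M.C o → Prop)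
  linearOrderOfSTO (· < ·)

theorem lt_suc_iff {m n : M.C o} : m < n + 1 ↔ m ≤ n := by
  rw [lt_suc_iff_lt_or_eq, le_iff_lt_or_eq]

theorem suc_le_iff {m n : M.C o} : m + 1 ≤ n ↔ m < n := by
  refine ⟨(lt_suc_self m).trans_le, fun h => ?_⟩
  obtain rfl | ⟨k, rfl⟩ := eq_zero_or_exists_eq_suc n
  · exact (Model.not_lt_zero m h).elim
  · obtain h | rfl := lt_suc_iff_lt_or_eq.1 h
    · exact (suc_lt_suc h).le
    · rfl

protected theorem zero_le (n : M.C o) : 0 ≤ n := lt_suc_iff.1 (suc_pos n)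

protected theorem add_lt_add_right {k m : M.C o} (h : k < m) (n : M.C o) : k + n < m + n := by
  induction n using qfInduction with
  | qf => fun_prop
  | zero => simpa only [add_zero] using h
  | succ n ih => simpa only [← add_assoc] using suc_lt_suc ih

instance : IsOrderedCancelAddMonoid (M.C o) where
  add_le_add_left k m h n := by
    obtain h | rfl := h.lt_or_eq
    · exact (Model.add_lt_add_right h n).le
    · rfl
  le_of_add_le_add_left k m n h := by
    contrapose! h
    simpa only [add_comm k] using Model.add_lt_add_right h k

theorem mul_suc_lt_mul_suc {k m : M.C o} (h : k < m) (n : M.C o) :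
    k * (n + 1) < m * (n + 1) := by
  induction n using qfInduction with
  | qf => fun_prop
  | zero => simpa only [zero_add, mul_one] using h
  | succ n ih =>
    rw [mul_suc, mul_suc m]
    exact add_lt_add ih h

instance : IsStrictOrderedRing (M.C o) where
  zero_le_one := Model.zero_le 1
  exists_pair_ne := ⟨0, 1, fun h => suc_ne_zero (0 : M.C o) (by rw [zero_add, h])⟩
  mul_lt_mul_of_pos_left n hn k m h := by
    obtain rfl | ⟨n, rfl⟩ := eq_zero_or_exists_eq_suc n
    · exact (lt_irrefl 0 hn).elim
    · simpa only [mul_comm] using mul_suc_lt_mul_suc h n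
  mul_lt_mul_of_pos_right n hn k m h := by
    obtain rfl | ⟨n, rfl⟩ := eq_zero_or_exists_eq_suc n
    · exact (lt_irrefl 0 hn).elim
    · exact mul_suc_lt_mul_suc h n

variable (M) in
/-- Truncated subtraction. -/
def sub : M.C (o ⇒ o ⇒ o) := M.recO (M.comK t1 o M.pred)

@[simp] theorem sub_zero (m : M.C o) : M.sub m 0 = m := recO_zero _ _

@[simp] theorem sub_suc (m n : M.C o) : M.sub m (n + 1) = M.pred (M.sub m n) := by simp [sub]

@[fun_prop]
theorem QFPred.le {f g : M.C o → M.C o} (hf : Rep f) (hg : Rep g) : QFPred fun n => f n ≤ g n := by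
  simp only [le_iff_lt_or_eq]
  fun_prop

theorem sub_add_cancel_of_le {m n : M.C o} : n ≤ m → M.sub m n + n = m := by
  induction n using qfInduction with
  | qf => exact .imp (by fun_prop) (by fun_prop)
  | zero => simp
  | succ n ih =>
    intro h
    have h_sub := ih ((lt_suc_self n).le.trans h)
    obtain h₀ | ⟨k, hk⟩ := eq_zero_or_exists_eq_suc (M.sub m n)
    · rw [h₀, zero_add] at h_sub
      exact ((suc_le_iff.1 h).ne h_sub).elim
    · rw [sub_suc, hk, pred_suc, ← add_assoc, add_right_comm, ← hk, h_sub]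

theorem sub_eq_zero_iff {m n : M.C o} : M.sub m n = 0 ↔ m ≤ n := by
  refine ⟨fun h => ?_, ?_⟩
  · contrapose! h
    intro h₀
    have h_sub := sub_add_cancel_of_le h.le
    rw [h₀, zero_add] at h_sub
    exact h.ne h_sub
  induction n using qfInduction with
  | qf => exact .imp (by fun_prop) (by fun_prop)
  | zero => simpa using fun h => le_antisymm h (Model.zero_le m)
  | succ n ih =>
    intro h
    obtain h | rfl := h.lt_or_eq
    · rw [sub_suc, ih (lt_suc_iff.1 h), pred_zero]
    · have h_sub : M.sub (n + 1) n = 0 + 1 :=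
        add_right_cancel ((sub_add_cancel_of_le (lt_suc_self n).le).trans (by ring))
      rw [sub_suc, h_sub, pred_suc]

theorem one_sub_eq_zero_iff {n : M.C o} : M.sub 1 n = 0 ↔ n ≠ 0 := by
  rw [sub_eq_zero_iff, ← zero_add 1, suc_le_iff]
  exact ⟨ne_of_gt, (Model.zero_le n).lt_of_ne'⟩

instance : CanonicallyOrderedAdd (M.C o) where
  exists_add_of_le {m n} h := ⟨M.sub n m, by rw [add_comm, sub_add_cancel_of_le h]⟩
  le_add_self m n := by simpa using Model.zero_le n
  le_self_add m n := by simpa using Model.zero_le n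

end Model

/-! ### Abstraction and arithmetical comprehension -/

/-- The term `λ x^σ. x`. -/
def identity (σ : Ty) : Tm (σ ⇒ σ) := Tm.comS σ (o ⇒ σ) σ ⬝ Tm.comK σ (o ⇒ σ) ⬝ Tm.comK σ o

/-- The term `λ x^σ. t`, where `x` is the variable `0` of type `σ`. -/
def Tm.abs (σ : Ty) : {τ : Ty} → Tm τ → Tm (σ ⇒ τ)
  | τ, .var _ n =>
    if h : σ = τ then
      match n with
      | 0 => h ▸ identity σ
      | n + 1 => .comK τ σ ⬝ .var τ n
    else .comK τ σ ⬝ .var τ n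
  | _, .app f a => .comS _ _ _ ⬝ f.abs σ ⬝ a.abs σ
  | _, .zero => .comK _ σ ⬝ .zero
  | _, .one => .comK _ σ ⬝ .one
  | _, .add => .comK _ σ ⬝ .add
  | _, .mul => .comK _ σ ⬝ .mul
  | _, .comK ρ τ => .comK _ σ ⬝ .comK ρ τ
  | _, .comS δ ρ τ => .comK _ σ ⬝ .comS δ ρ τ
  | _, .recO => .comK _ σ ⬝ .recO

/-- Formulas with quantifiers over the type `o` only. -/
def Fml.Arith : Fml → Prop
  | eq _ _ => True
  | lt _ _ => True
  | bot => True
  | imp φ ψ => Arith φ ∧ Arith ψ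
  | all σ φ => σ = o ∧ Arith φ

theorem Fml.Arith.subst {φ : Fml} (h : φ.Arith) (s : Sub) : (φ.subst s).Arith := by
  induction φ generalizing s with
  | imp φ ψ ih₁ ih₂ => exact ⟨ih₁ h.1 s, ih₂ h.2 s⟩
  | all σ φ ih => exact ⟨h.1, ih h.2 (s.lift σ)⟩
  | _ => trivial

/-- Truncated subtraction, as a closed term. -/
def subTm : Tm (o ⇒ o ⇒ o) := Tm.recO ⬝ (Tm.comK t1 o ⬝ (Tm.recO ⬝ Tm.comK o o ⬝ .zero))

/-- A term that vanishes if and only if `φ` holds, provided that `φ` is arithmetical and that the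
variable `0` of type `2` denotes a functional as in `(∃²)`. -/
def Fml.char : Fml → Tm o
  | eq s t => plus (subTm ⬝ s ⬝ t) (subTm ⬝ t ⬝ s)
  | lt s t => subTm ⬝ suc s ⬝ t
  | bot => .one
  | imp φ ψ => times (subTm ⬝ .one ⬝ φ.char) ψ.char
  | all _ φ => subTm ⬝ .one ⬝ (.var t2 0 ⬝ (subTm ⬝ .one ⬝ φ.char).abs o)

namespace Model

/-- `M` is a model of `ACA₀^ω`. -/
class IsACA (M : Model) : Prop where
  sat : M.Sat ACA0

instance [hM : M.IsACA] : M.IsRCA := ⟨fun φ hφ => hM.sat φ (Set.mem_insert_of_mem _ hφ)⟩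

/-- The functional `Φ` decides whether a sequence has a zero, as in `(∃²)`. -/
def IsExistsTwo (Φ : M.C t2) : Prop := ∀ f : M.C t1, (∃ n : M.C o, f n = 0) ↔ Φ f = 0

variable (M) in
theorem exists_isExistsTwo [hM : M.IsACA] : ∃ Φ : M.C t2, IsExistsTwo Φ := by
  have h := hM.sat existsTwo (Set.mem_insert _ _) default
  simp only [existsTwo, Fml.eval_ex, Fml.eval_and, Fml.eval_all, Fml.eval_iff, Fml.eval_eq,
    Tm.eval, Env.cons_zero, Env.cons_ne (show t1 ≠ t2 by decide),
    Env.cons_ne (show o ≠ t1 by decide)] at h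
  exact h.imp fun _ => And.right

theorem eval_subTm (e : M.Env) (s t : Tm o) :
    (subTm ⬝ s ⬝ t).eval e = M.sub (s.eval e) (t.eval e) := rfl

section Abstraction

variable [M.IsRCA] {ρ σ τ : Ty}

@[simp] theorem eval_abs (t : Tm τ) (e : M.Env) (x : M.C σ) :
    (t.abs σ).eval e x = t.eval (Env.cons x e) := by
  induction t with
  | var τ n =>
    obtain rfl | h := eq_or_ne σ τ
    · cases n <;> simp [Tm.abs, Tm.eval, identity]
    · simp [Tm.abs, Tm.eval, h, Env.cons_ne h]
  | app f a ihf iha => simp [Tm.abs, Tm.eval, ihf, iha]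
  | _ => simp [Tm.abs, Tm.eval]

theorem exists_eq_eval (t : Tm τ) (e : M.Env) :
    ∃ F : M.C (ρ ⇒ σ ⇒ τ), ∀ x y, F x y = t.eval (Env.cons y (Env.cons x e)) :=
  ⟨((t.abs σ).abs ρ).eval e, fun x y => by simp⟩

theorem eval_char {φ : Fml} (hφ : φ.Arith) {e : M.Env} (he : IsExistsTwo (e t2 0)) :
    φ.char.eval e = 0 ↔ φ.eval e := by
  induction φ generalizing e with
  | eq s t =>
    rw [Fml.char, eval_plus, eval_subTm, eval_subTm, add_eq_zero, sub_eq_zero_iff,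
      sub_eq_zero_iff, Fml.eval_eq]
    exact antisymm_iff
  | lt s t =>
    rw [Fml.char, eval_subTm, eval_suc, sub_eq_zero_iff, suc_le_iff]
    rfl
  | bot => exact iff_of_false one_ne_zero id
  | imp φ ψ ih₁ ih₂ =>
    rw [Fml.char, eval_times, eval_subTm, eval_one, mul_eq_zero, one_sub_eq_zero_iff, Ne,
      ih₁ hφ.1 he, ih₂ hφ.2 he, Fml.eval_imp, imp_iff_not_or]
  | all σ φ ih =>
    obtain ⟨rfl, hφ⟩ := hφ
    rw [Fml.char, eval_subTm, eval_one, one_sub_eq_zero_iff]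
    simp only [Tm.eval]
    rw [Ne, ← he, not_exists, Fml.eval_all]
    refine forall_congr' fun n => ?_
    rw [eval_abs, eval_subTm, eval_one, one_sub_eq_zero_iff, not_not,
      ih hφ (by rwa [Env.cons_ne (by decide)])]

end Abstraction

open Classical in
/-- The functional `Φ` enters as the value of an additional variable, which is then abstracted,
so that it cannot be captured by `x` or `y`. -/
theorem exists_indicator [M.IsACA] {σ τ : Ty} {φ : Fml} (hφ : φ.Arith) (e : M.Env) :
    ∃ F : M.C (σ ⇒ τ ⇒ o), ∀ x y, F x y = if φ.eval (Env.cons y (Env.cons x e)) then 1 else 0 := by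
  obtain ⟨Φ, hΦ⟩ := exists_isExistsTwo M
  obtain ⟨G, hG⟩ := exists_eq_eval (ρ := σ) (σ := τ) ((φ.wk t2).char.abs t2) e
  obtain ⟨H, hH⟩ : Rep fun z : M.C (t2 ⇒ o) => M.sub 1 (z Φ) := by fun_prop
  obtain ⟨F, hF⟩ : Rep fun x => M.comS τ (t2 ⇒ o) o (M.comK ((t2 ⇒ o) ⇒ o) τ H) (G x) := by
    fun_prop
  refine ⟨F, fun x y => ?_⟩
  have h_char := eval_char (hφ.subst _) (e := Env.cons Φ (Env.cons y (Env.cons x e)))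
    (φ := φ.wk t2) (by rwa [Env.cons_zero])
  rw [Fml.eval_wk] at h_char
  simp only [hF, hH, hG, comS_apply, comK_apply, eval_abs]
  split_ifs with h
  · rw [h_char.2 h, sub_zero]
  · rwa [one_sub_eq_zero_iff, Ne, h_char]

end Model

/-! ### Codes of rational numbers -/

namespace Model

section Eval

variable (e : M.Env) (s t : Tm o)

theorem eval_le_iff [M.IsRCA] : (Fml.le s t).eval e ↔ s.eval e ≤ t.eval e := by
  rw [Fml.eval_le, le_iff_lt_or_eq]
  rfl

variable (M) in
/-- The function `n ↦ 2 ^ n`, as an object of the model. -/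
def twoPow : M.C t1 := pow2.eval default

theorem eval_pow2 : (pow2 ⬝ t).eval e = M.twoPow (t.eval e) := rfl

/-- The injective pairing `(s, t) ↦ (s + t)² + s`. -/
def natPair (s t : M.C o) : M.C o := (s + t) * (s + t) + s

theorem eval_pair : (pair s t).eval e = natPair (s.eval e) (t.eval e) := rfl

/-- The code of the rational number `(a - b) / (d + 1)`. -/
def code (a b d : M.C o) : M.C o := natPair (natPair a b) d

theorem eval_ratCode (a b d : Tm o) :
    (ratCode a b d).eval e = code (a.eval e) (b.eval e) (d.eval e) := rfl

end Eval

theorem eval_wk_two {τ : Ty} (t : Tm τ) (x₁ x₂ : M.C o) (e : M.Env) :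
    (t.wk o 2).eval (Env.cons x₁ (Env.cons x₂ e)) = t.eval e := by
  rw [Tm.eval_wk_add_one, Tm.eval_wk]

theorem eval_wk_six (t : Tm o) (x₁ x₂ x₃ x₄ x₅ x₆ : M.C o) (e : M.Env) :
    (t.wk o 6).eval (Env.cons x₁ (Env.cons x₂ (Env.cons x₃ (Env.cons x₄ (Env.cons x₅
      (Env.cons x₆ e)))))) = t.eval e := by
  rw [Tm.eval_wk_add_one, Tm.eval_wk_add_one, Tm.eval_wk_add_one, Tm.eval_wk_add_one,
    eval_wk_two]

section TwoPow

variable [M.IsRCA]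

@[fun_prop]
theorem Rep.pow {σ : Ty} {f : M.C σ → M.C o} (hf : Rep f) (n : ℕ) : Rep fun x => f x ^ n := by
  induction n with
  | zero => simpa only [pow_zero] using .const 1
  | succ n ih => simpa only [pow_succ] using ih.mul hf

@[simp] theorem twoPow_zero : M.twoPow 0 = 1 := recO_zero _ _

@[simp] theorem twoPow_suc (n : M.C o) : M.twoPow (n + 1) = 2 * M.twoPow n := by
  rw [two_mul]
  refine (recO_suc _ _ _).trans ?_
  simp only [Tm.eval, idT, comK_apply, comS_apply]
  rfl

theorem lt_twoPow (n : M.C o) : n < M.twoPow n := by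
  induction n using qfInduction with
  | qf => fun_prop
  | zero => simp
  | succ n ih =>
    rw [twoPow_suc, two_mul]
    exact add_lt_add_of_lt_of_le ih (by simpa using suc_le_iff.2 ((Model.zero_le n).trans_lt ih))

theorem twoPow_pos (n : M.C o) : 0 < M.twoPow n := (Model.zero_le n).trans_lt (lt_twoPow n)

theorem one_le_twoPow (n : M.C o) : 1 ≤ M.twoPow n := by
  simpa using suc_le_iff.2 (twoPow_pos n)

theorem twoPow_add (m n : M.C o) : M.twoPow (m + n) = M.twoPow m * M.twoPow n := by
  induction n using qfInduction with
  | qf => fun_prop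
  | zero => simp
  | succ n ih => rw [← add_assoc, twoPow_suc, ih, twoPow_suc, mul_left_comm]

end TwoPow

section Code

variable [M.IsRCA] {s t s' t' a b d a' b' d' : M.C o}

theorem natPair_lt_natPair_of_add_lt_add (h : s + t < s' + t') : natPair s t < natPair s' t' :=
  calc natPair s t ≤ (s + t) * (s + t) + (s + t) := add_le_add_right le_self_add _
    _ < (s + t) * (s + t) + (s + t) + (s + t + 1) := lt_add_of_pos_right _ (suc_pos _)
    _ = (s + t + 1) * (s + t + 1) := by ring
    _ ≤ (s' + t') * (s' + t') := by
      have := suc_le_iff.2 h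
      gcongr
    _ ≤ natPair s' t' := le_self_add

theorem natPair_inj : natPair s t = natPair s' t' ↔ s = s' ∧ t = t' := by
  refine ⟨fun h => ?_, fun h => by rw [h.1, h.2]⟩
  have h_add : s + t = s' + t' := by
    refine le_antisymm (le_of_not_gt fun h_gt => ?_) (le_of_not_gt fun h_lt => ?_)
    · exact (natPair_lt_natPair_of_add_lt_add h_gt).ne' h
    · exact (natPair_lt_natPair_of_add_lt_add h_lt).ne h
  rw [natPair, natPair, h_add] at h
  obtain rfl := add_left_cancel h
  exact ⟨rfl, add_left_cancel h_add⟩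

theorem code_inj : code a b d = code a' b' d' ↔ a = a' ∧ b = b' ∧ d = d' := by
  rw [code, code, natPair_inj, natPair_inj, and_assoc]

end Code

/-- The number `p` is the code of a rational number. -/
def IsRat (p : M.C o) : Prop := ∃ a b d, p = code a b d

variable [M.IsRCA]

/-- The numbers `p` and `q` are codes of rational numbers with `p ≤ q + u / v`. -/
def RatLe (p q u v : M.C o) : Prop :=
  ∃ a b d a₁ b₁ d₁ : M.C o, p = code a b d ∧ q = code a₁ b₁ d₁ ∧
    v * (a * (d₁ + 1) + b₁ * (d + 1)) ≤
      v * (a₁ * (d + 1) + b * (d₁ + 1)) + u * ((d + 1) * (d₁ + 1))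

namespace RatLe

variable {p q r u v u' v' a b d a' b' d' : M.C o}

theorem isRat_left (h : RatLe p q u v) : IsRat p :=
  let ⟨a, b, d, _, _, _, hp, _⟩ := h
  ⟨a, b, d, hp⟩

theorem isRat_right (h : RatLe p q u v) : IsRat q :=
  let ⟨_, _, _, a, b, d, _, hq, _⟩ := h
  ⟨a, b, d, hq⟩

theorem code_iff : RatLe (code a b d) (code a' b' d') u v ↔
    v * (a * (d' + 1) + b' * (d + 1)) ≤
      v * (a' * (d + 1) + b * (d' + 1)) + u * ((d + 1) * (d' + 1)) := by
  refine ⟨?_, fun h => ⟨a, b, d, a', b', d', rfl, rfl, h⟩⟩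
  rintro ⟨_, _, _, _, _, _, h_code, h_code', h⟩
  obtain ⟨rfl, rfl, rfl⟩ := code_inj.1 h_code
  obtain ⟨rfl, rfl, rfl⟩ := code_inj.1 h_code'
  exact h

theorem mono (h : RatLe p q u v) (hv : 0 < v) (h_bound : u * v' ≤ u' * v) :
    RatLe p q u' v' := by
  obtain ⟨a, b, d, a', b', d', rfl, rfl, h⟩ := h
  refine code_iff.2 (le_of_mul_le_mul_left ?_ hv)
  calc v * (v' * (a * (d' + 1) + b' * (d + 1)))
      = v' * (v * (a * (d' + 1) + b' * (d + 1))) := by ring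
    _ ≤ v' * (v * (a' * (d + 1) + b * (d' + 1)) + u * ((d + 1) * (d' + 1))) := by gcongr
    _ = v * (v' * (a' * (d + 1) + b * (d' + 1))) + (u * v') * ((d + 1) * (d' + 1)) := by ring
    _ ≤ v * (v' * (a' * (d + 1) + b * (d' + 1))) + (u' * v) * ((d + 1) * (d' + 1)) := by gcongr
    _ = v * (v' * (a' * (d + 1) + b * (d' + 1)) + u' * ((d + 1) * (d' + 1))) := by ring

theorem trans (h₁ : RatLe p q u v) (h₂ : RatLe q r u' v') :
    RatLe p r (u * v' + u' * v) (v * v') := by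
  obtain ⟨a, b, d, rfl⟩ := h₁.isRat_left
  obtain ⟨a₁, b₁, d₁, rfl⟩ := h₂.isRat_left
  obtain ⟨a₂, b₂, d₂, rfl⟩ := h₂.isRat_right
  rw [code_iff] at *
  refine le_of_mul_le_mul_left ?_ (suc_pos d₁)
  refine le_of_add_le_add_right (a := v * v' * ((d + 1) * (d₂ + 1)) * (a₁ + b₁)) ?_
  calc _ = v' * (d₂ + 1) * (v * (a * (d₁ + 1) + b₁ * (d + 1))) +
        v * (d + 1) * (v' * (a₁ * (d₂ + 1) + b₂ * (d₁ + 1))) := by ring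
    _ ≤ v' * (d₂ + 1) * (v * (a₁ * (d + 1) + b * (d₁ + 1)) + u * ((d + 1) * (d₁ + 1))) +
        v * (d + 1) * (v' * (a₂ * (d₁ + 1) + b₁ * (d₂ + 1)) + u' * ((d₁ + 1) * (d₂ + 1))) := by
      gcongr
    _ = _ := by ring

/-- If `p > q + u / v`, then the difference of the two sides is at least `1 / N` for a number `N`
which depends on the denominators only; hence `u' / 2 ^ n` is too small for large `n`. -/
theorem of_forall_twoPow
    (h : ∀ n : M.C o, RatLe p q (u * M.twoPow n + u' * v) (v * M.twoPow n)) :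
    RatLe p q u v := by
  obtain ⟨a, b, d, rfl⟩ := (h 0).isRat_left
  obtain ⟨a', b', d', rfl⟩ := (h 0).isRat_right
  simp only [code_iff] at *
  by_contra! h_lt
  obtain ⟨n, hn⟩ : ∃ n, n = u' * v * ((d + 1) * (d' + 1)) := ⟨_, rfl⟩
  set R := v * (a' * (d + 1) + b * (d' + 1)) + u * ((d + 1) * (d' + 1))
  refine (lt_twoPow n).not_ge (le_of_add_le_add_left (a := M.twoPow n * R) ?_)
  calc M.twoPow n * R + M.twoPow n = M.twoPow n * (R + 1) := by ring
    _ ≤ M.twoPow n * (v * (a * (d' + 1) + b' * (d + 1))) := by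
      have := suc_le_iff.2 h_lt
      gcongr
    _ = v * M.twoPow n * (a * (d' + 1) + b' * (d + 1)) := by ring
    _ ≤ v * M.twoPow n * (a' * (d + 1) + b * (d' + 1)) +
        (u * M.twoPow n + u' * v) * ((d + 1) * (d' + 1)) := h n
    _ = M.twoPow n * R + u' * v * ((d + 1) * (d' + 1)) := by ring
    _ = M.twoPow n * R + n := by rw [hn]

end RatLe

/-- The number `s` is a code of `q + 1 / v`. -/
theorem IsRat.exists_add_inv {q v : M.C o} (hq : IsRat q) (hv : 0 < v) :
    ∃ s, ∀ p u w, RatLe p s u w ↔ RatLe p q (u * v + w) (w * v) := by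
  obtain ⟨a, b, d, rfl⟩ := hq
  obtain rfl | ⟨m, rfl⟩ := eq_zero_or_exists_eq_suc v
  · exact (lt_irrefl 0 hv).elim
  have h_denom : (d * m + d + m) + 1 = (d + 1) * (m + 1) := by ring
  refine ⟨code (a * (m + 1) + (d + 1)) (b * (m + 1)) (d * m + d + m), fun p u w => ?_⟩
  by_cases hp : IsRat p
  · obtain ⟨a', b', d', rfl⟩ := hp
    rw [RatLe.code_iff, RatLe.code_iff, h_denom]
    apply iff_of_eq
    congr 1 <;> ring
  · exact iff_of_false (fun h => hp h.isRat_left) fun h => hp h.isRat_left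

/-! ### The four spaces -/

/-- The object `x` represents a real number. -/
def IsReal (x : M.C t1) : Prop := ∀ k i : M.C o,
  RatLe (x k) (x (k + i)) 1 (M.twoPow k) ∧ RatLe (x (k + i)) (x k) 1 (M.twoPow k)

/-- The order of real numbers. -/
def RealLe (x y : M.C t1) : Prop := ∀ k : M.C o, RatLe (x k) (y k) (1 + 1) (M.twoPow k)

/-- The equality of real numbers. -/
def RealEq (x y : M.C t1) : Prop := RealLe x y ∧ RealLe y x

/-- The object `x` represents a real number in the unit interval. -/
def IsUnitReal (x : M.C t1) : Prop :=
  IsReal x ∧ RealLe (M.comK o o (code 0 0 0)) x ∧ RealLe x (M.comK o o (code 1 0 0))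

/-- The object `f` is an element of Cantor space. -/
def IsCantor (f : M.C t1) : Prop := ∀ n : M.C o, f n ≤ 1

section Eval

variable (e : M.Env)

theorem eval_ratLeAdd (p q u k : Tm o) : (ratLeAdd p q u k).eval e ↔
    RatLe (p.eval e) (q.eval e) (u.eval e) (M.twoPow (k.eval e)) := by
  simp only [ratLeAdd, Fml.eval_ex, Fml.eval_and, Fml.eval_eq, eval_le_iff, eval_wk_six,
    eval_ratCode, eval_times, eval_plus, eval_suc, eval_pow2]
  rfl

theorem eval_inReal (x : Tm t1) : (inReal x).eval e ↔ IsReal (x.eval e) := by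
  simp only [inReal, Fml.eval_all, Fml.eval_and, eval_ratLeAdd, Tm.eval, eval_wk_two]
  rfl

theorem eval_leReal (x y : Tm t1) : (leReal x y).eval e ↔ RealLe (x.eval e) (y.eval e) := by
  simp only [leReal, Fml.eval_all, eval_ratLeAdd, Tm.eval, Tm.eval_wk]
  rfl

theorem eval_eqReal (x y : Tm t1) : (eqReal x y).eval e ↔ RealEq (x.eval e) (y.eval e) := by
  rw [eqReal, Fml.eval_and, eval_leReal, eval_leReal, RealEq]

theorem eval_inUnit (x : Tm t1) : (inUnit x).eval e ↔ IsUnitReal (x.eval e) := by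
  simp only [inUnit, Fml.eval_and, eval_inReal, eval_leReal]
  rfl

theorem eval_inCantor (f : Tm t1) : (inCantor f).eval e ↔ IsCantor (f.eval e) := by
  simp only [inCantor, Fml.eval_all, eval_le_iff, Tm.eval, Tm.eval_wk]
  rfl

end Eval

end Model

/-! ### Injections to the natural numbers -/

namespace Model

section Injects

variable {σ τ : Ty}

/-- There is an injection to the natural numbers from the space with the points `D` and the
equality `E`. -/
def Injects (D : M.C σ → Prop) (E : M.C σ → M.C σ → Prop) : Prop :=
  ∃ Y : M.C (σ ⇒ o), (∀ x y, D x → D y → E x y → Y x = Y y) ∧ ∀ x y, D x → D y → Y x = Y y → E x y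

theorem Injects.comap [M.IsRCA] {D : M.C σ → Prop} {D' : M.C τ → Prop}
    {E : M.C σ → M.C σ → Prop} {E' : M.C τ → M.C τ → Prop} (h : Injects D' E')
    (F : M.C (σ ⇒ τ)) (hD : ∀ x, D x → D' (F x))
    (hE : ∀ x y, D x → D y → (E x y ↔ E' (F x) (F y))) : Injects D E := by
  obtain ⟨Y, h_map, h_inj⟩ := h
  obtain ⟨Z, hZ : ∀ x, Z x = Y (F x)⟩ : Rep fun x => Y (F x) := by fun_prop
  refine ⟨Z, fun x y hx hy h => ?_, fun x y hx hy h => ?_⟩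
  · rw [hZ, hZ, h_map _ _ (hD x hx) (hD y hy) ((hE x y hx hy).1 h)]
  · rw [hZ, hZ] at h
    exact (hE x y hx hy).2 (h_inj _ _ (hD x hx) (hD y hy) h)

theorem eval_noInjection {D : Tm t1 → Fml} {E : Tm t1 → Tm t1 → Fml} {D' : M.C t1 → Prop}
    {E' : M.C t1 → M.C t1 → Prop} (hD : ∀ e x, (D x).eval e ↔ D' (x.eval e))
    (hE : ∀ e x y, (E x y).eval e ↔ E' (x.eval e) (y.eval e)) (e : M.Env) :
    (noInjection D E).eval e ↔ ¬ Injects D' E' := by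
  simp only [noInjection, Injects, Fml.eval_neg, Fml.eval_ex, Fml.eval_and, Fml.eval_all,
    Fml.eval_imp, Fml.eval_eq, hD, hE, Tm.eval, Env.cons_zero,
    Env.cons_ne (show t1 ≠ t2 by decide)]
  rfl

end Injects

section RCA

variable [M.IsRCA]

theorem injects_unit_of_injects_real (h : Injects (M := M) IsReal RealEq) :
    Injects (M := M) IsUnitReal RealEq := by
  obtain ⟨Y, h_map, h_inj⟩ := h
  exact ⟨Y, fun x y hx hy => h_map x y hx.1 hy.1, fun x y hx hy => h_inj x y hx.1 hy.1⟩

/-! ### Binary sequences as real numbers -/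

variable (M) in
theorem exists_num : ∃ N : M.C (t1 ⇒ t1), ∀ f, N f 0 = 0 ∧ ∀ k, N f (k + 1) = 4 * N f k + f k := by
  let r : Tm o := .var o 0
  let step : Tm o := plus (plus (plus r r) (plus r r)) (.var t1 0 ⬝ .var o 1)
  let G : M.C (t1 ⇒ o ⇒ o ⇒ o) := (((step.abs o).abs o).abs t1).eval default
  have hG (f : M.C t1) (k m : M.C o) : G f k m = m + m + (m + m) + f k := by
    simp only [G, step, r, eval_abs, eval_plus, Tm.eval, Env.cons_zero,
      Env.cons_ne (show o ≠ t1 by decide)]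
    rfl
  obtain ⟨N, hN⟩ : Rep fun f => M.recO (G f) 0 := by fun_prop
  refine ⟨N, fun f => ⟨by rw [hN, recO_zero], fun k => ?_⟩⟩
  rw [hN, recO_suc, hG]
  ring

variable (M) in
/-- The numerators of the partial sums of `∑ f(n) / 4 ^ (n + 1)`: the value `M.num f k` is the
numerator, for the denominator `4 ^ k`, of the sum of the first `k` terms. -/
noncomputable def num : M.C (t1 ⇒ t1) := (exists_num M).choose

variable {f g : M.C t1} {k : M.C o}

@[simp] theorem num_zero (f : M.C t1) : M.num f 0 = 0 := ((exists_num M).choose_spec f).1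

theorem num_suc (f : M.C t1) (k : M.C o) : M.num f (k + 1) = 4 * M.num f k + f k :=
  ((exists_num M).choose_spec f).2 k

theorem le_num_add (f : M.C t1) (k i : M.C o) :
    M.twoPow i ^ 2 * M.num f k ≤ M.num f (k + i) := by
  induction i using qfInduction with
  | qf => fun_prop
  | zero => simp
  | succ i ih =>
    rw [← add_assoc, num_suc, twoPow_suc]
    calc (2 * M.twoPow i) ^ 2 * M.num f k = 4 * (M.twoPow i ^ 2 * M.num f k) := by ring
      _ ≤ 4 * M.num f (k + i) := by gcongr
      _ ≤ 4 * M.num f (k + i) + f (k + i) := le_self_add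

/-- The summand `1` on both sides comes from `3 ∑_{j < i} 4 ^ j + 1 = 4 ^ i`. -/
theorem num_add_le (hf : IsCantor f) (k i : M.C o) :
    3 * M.num f (k + i) + 1 ≤ M.twoPow i ^ 2 * (3 * M.num f k + 1) := by
  induction i using qfInduction with
  | qf => fun_prop
  | zero => simp
  | succ i ih =>
    rw [← add_assoc, num_suc, twoPow_suc]
    calc 3 * (4 * M.num f (k + i) + f (k + i)) + 1
        ≤ 3 * (4 * M.num f (k + i) + 1) + 1 := by
          have := hf (k + i)
          gcongr
      _ = 4 * (3 * M.num f (k + i) + 1) := by ring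
      _ ≤ 4 * (M.twoPow i ^ 2 * (3 * M.num f k + 1)) := by gcongr
      _ = (2 * M.twoPow i) ^ 2 * (3 * M.num f k + 1) := by ring

theorem num_add_le_mul_add_one (hf : IsCantor f) (k i : M.C o) :
    M.num f (k + i) ≤ M.twoPow i ^ 2 * (M.num f k + 1) := by
  refine le_of_mul_le_mul_left ?_ (show (0 : M.C o) < 3 by positivity)
  calc 3 * M.num f (k + i) ≤ 3 * M.num f (k + i) + 1 := le_self_add
    _ ≤ M.twoPow i ^ 2 * (3 * M.num f k + 1) := num_add_le hf k i
    _ ≤ M.twoPow i ^ 2 * (3 * M.num f k + 1) + M.twoPow i ^ 2 * 2 := le_self_add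
    _ = 3 * (M.twoPow i ^ 2 * (M.num f k + 1)) := by ring

theorem num_gap (hf : IsCantor f) (hfk : f k = 0) (hgk : g k = 1) (h : M.num f k = M.num g k)
    (i : M.C o) :
    3 * M.num f (k + 1 + i) + 2 * M.twoPow i ^ 2 + 1 ≤ 3 * M.num g (k + 1 + i) :=
  calc 3 * M.num f (k + 1 + i) + 2 * M.twoPow i ^ 2 + 1
      = 3 * M.num f (k + 1 + i) + 1 + 2 * M.twoPow i ^ 2 := by ring
    _ ≤ M.twoPow i ^ 2 * (3 * M.num f (k + 1) + 1) + 2 * M.twoPow i ^ 2 := by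
      gcongr
      exact num_add_le hf (k + 1) i
    _ = 3 * (M.twoPow i ^ 2 * M.num g (k + 1)) := by
      rw [num_suc, num_suc, hfk, hgk, h]
      ring
    _ ≤ 3 * M.num g (k + 1 + i) := by
      gcongr
      exact le_num_add g (k + 1) i

theorem pred_twoPow_sq_add_one (k : M.C o) : M.pred (M.twoPow k ^ 2) + 1 = M.twoPow k ^ 2 := by
  obtain h | ⟨m, hm⟩ := eq_zero_or_exists_eq_suc (M.twoPow k ^ 2)
  · exact ((pow_pos (twoPow_pos k) 2).ne' h).elim
  · rw [hm, pred_suc]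

variable (M) in
theorem exists_binarySum :
    ∃ F : M.C (t1 ⇒ t1), ∀ f k, F f k = code (M.num f k) 0 (M.pred (M.twoPow k ^ 2)) := by
  obtain ⟨d, hd : ∀ k, d k = M.pred (M.twoPow k ^ 2)⟩ :
      Rep fun k => M.pred (M.twoPow k ^ 2) := by fun_prop
  obtain ⟨F, hF⟩ := exists_eq_eval (ρ := t1) (σ := o)
    (ratCode (.var (t1 ⇒ t1) 0 ⬝ .var t1 0 ⬝ .var o 0) .zero (.var t1 1 ⬝ .var o 0))
    (Env.cons M.num (Env.cons d default))
  refine ⟨F, fun f k => ?_⟩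
  rw [hF, eval_ratCode, ← hd]
  simp only [Tm.eval, ne_eq, reduceCtorEq, not_false_eq_true, Env.cons_ne, arr.injEq, and_self,
    Env.cons_zero, Env.cons_succ]
  rfl

variable (M) in
/-- The map `f ↦ ∑ f(n) / 4 ^ (n + 1)`. -/
noncomputable def binarySum : M.C (t1 ⇒ t1) := (exists_binarySum M).choose

theorem binarySum_apply (f : M.C t1) (k : M.C o) :
    M.binarySum f k = code (M.num f k) 0 (M.pred (M.twoPow k ^ 2)) :=
  (exists_binarySum M).choose_spec f k

theorem isReal_binarySum (hf : IsCantor f) : IsReal (M.binarySum f) := fun k i => by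
  simp only [binarySum_apply, RatLe.code_iff, pred_twoPow_sq_add_one, zero_mul, add_zero]
  rw [twoPow_add]
  set p := M.twoPow k
  set q := M.twoPow i
  constructor
  · calc p * (M.num f k * (p * q) ^ 2) = p ^ 3 * (q ^ 2 * M.num f k) := by ring
      _ ≤ p ^ 3 * M.num f (k + i) := by
        gcongr
        exact le_num_add f k i
      _ = p * (M.num f (k + i) * p ^ 2) := by ring
      _ ≤ p * (M.num f (k + i) * p ^ 2) + 1 * (p ^ 2 * (p * q) ^ 2) := le_self_add
  · calc p * (M.num f (k + i) * p ^ 2) = p ^ 3 * M.num f (k + i) := by ring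
      _ ≤ p ^ 3 * (q ^ 2 * (M.num f k + 1)) := by
        gcongr
        exact num_add_le_mul_add_one hf k i
      _ = p * (M.num f k * (p * q) ^ 2) + 1 * (p ^ 3 * q ^ 2) := by ring
      _ ≤ p * (M.num f k * (p * q) ^ 2) + p * (p ^ 3 * q ^ 2) := by
        have := one_le_twoPow k
        gcongr
      _ = p * (M.num f k * (p * q) ^ 2) + 1 * ((p * q) ^ 2 * p ^ 2) := by ring

theorem isUnitReal_binarySum (hf : IsCantor f) : IsUnitReal (M.binarySum f) := by
  refine ⟨isReal_binarySum hf, fun k => ?_, fun k => ?_⟩ <;>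
  simp only [comK_apply, binarySum_apply, RatLe.code_iff, pred_twoPow_sq_add_one, zero_mul,
    zero_add, add_zero, mul_zero, one_mul, mul_one]
  · exact Model.zero_le _
  · refine le_trans ?_ le_self_add
    gcongr
    simpa using num_add_le_mul_add_one hf 0 k

theorem num_le_of_realLe (h : RealLe (M.binarySum f) (M.binarySum g)) (k : M.C o) :
    M.num f k ≤ M.num g k + 2 * M.twoPow k := by
  have h_k := h k
  simp only [binarySum_apply, RatLe.code_iff, pred_twoPow_sq_add_one, zero_mul, add_zero,
    one_add_one_eq_two] at h_k
  have := twoPow_pos k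
  refine le_of_mul_le_mul_left ?_ (show 0 < M.twoPow k ^ 3 by positivity)
  calc M.twoPow k ^ 3 * M.num f k = M.twoPow k * (M.num f k * M.twoPow k ^ 2) := by ring
    _ ≤ M.twoPow k * (M.num g k * M.twoPow k ^ 2) +
        2 * (M.twoPow k ^ 2 * M.twoPow k ^ 2) := h_k
    _ = M.twoPow k ^ 3 * (M.num g k + 2 * M.twoPow k) := by ring

/-- Evaluated at precision `(k + 1) + (k + 3)`, where the error `2 / 2 ^ (2 k + 4)` is less than the
gap `(2 / 3) / 4 ^ (k + 1)`. -/
theorem not_realLe_binarySum (hf : IsCantor f) (hfk : f k = 0) (hgk : g k = 1)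
    (h : M.num f k = M.num g k) : ¬ RealLe (M.binarySum g) (M.binarySum f) := fun h_le => by
  set p := M.twoPow (k + 1) with hp
  have hq : M.twoPow (k + 1 + 1 + 1) = 4 * p := by
    rw [twoPow_suc, twoPow_suc (k + 1)]
    ring
  have h_gap := num_gap hf hfk hgk h (k + 1 + 1 + 1)
  have h_num := num_le_of_realLe h_le (k + 1 + (k + 1 + 1 + 1))
  rw [twoPow_add, ← hp, hq] at h_num
  rw [hq] at h_gap
  set m := M.num f (k + 1 + (k + 1 + 1 + 1))
  refine (suc_pos (8 * p ^ 2)).not_ge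
    (le_of_add_le_add_left (a := 3 * m + 24 * p ^ 2) ?_)
  calc 3 * m + 24 * p ^ 2 + (8 * p ^ 2 + 1) = 3 * m + 2 * (4 * p) ^ 2 + 1 := by ring
    _ ≤ 3 * M.num g (k + 1 + (k + 1 + 1 + 1)) := h_gap
    _ ≤ 3 * (m + 2 * (p * (4 * p))) := by gcongr
    _ = 3 * m + 24 * p ^ 2 + 0 := by ring

theorem IsCantor.eq_zero_or_eq_one (hf : IsCantor f) (k : M.C o) : f k = 0 ∨ f k = 1 := by
  obtain h | h := (hf k).lt_or_eq
  · rw [← zero_add 1, lt_suc_iff] at h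
    exact .inl (le_antisymm h (Model.zero_le _))
  · exact .inr h

theorem IsReal.realLe_refl {x : M.C t1} (hx : IsReal x) : RealLe x x := fun k => by
  have h := (hx k 0).1
  rw [add_zero] at h
  refine h.mono (twoPow_pos k) ?_
  gcongr
  exact le_self_add

theorem eq_of_realEq_binarySum (hf : IsCantor f) (hg : IsCantor g)
    (h : RealEq (M.binarySum f) (M.binarySum g)) : f = g := by
  have apply_eq (k : M.C o) (hk : M.num f k = M.num g k) : f k = g k := by
    obtain hfk | hfk := hf.eq_zero_or_eq_one k <;> obtain hgk | hgk := hg.eq_zero_or_eq_one k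
    · rw [hfk, hgk]
    · exact (not_realLe_binarySum hf hfk hgk hk h.2).elim
    · exact (not_realLe_binarySum hg hgk hfk hk.symm h.1).elim
    · rw [hfk, hgk]
  refine M.ext fun k => apply_eq k ?_
  induction k using qfInduction with
  | qf => fun_prop
  | zero => simp
  | succ k ih => rw [num_suc, num_suc, ih, apply_eq k ih]

theorem injects_cantor_of_injects_unit (h : Injects (M := M) IsUnitReal RealEq) :
    Injects (M := M) IsCantor Eq := by
  refine h.comap M.binarySum (fun f => isUnitReal_binarySum) fun f g hf hg => ⟨?_, ?_⟩
  · rintro rfl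
    exact ⟨(isReal_binarySum hf).realLe_refl, (isReal_binarySum hf).realLe_refl⟩
  · exact eq_of_realEq_binarySum hf hg

/-! ### Real numbers as sets of rational numbers -/

/-- The number `p` is the code of a rational upper bound of the real number `x`. -/
def UpperBound (x : M.C t1) (p : M.C o) : Prop := ∀ k : M.C o, RatLe (x k) p 1 (M.twoPow k)

variable {x y : M.C t1}

theorem UpperBound.of_realLe {p : M.C o} (h : UpperBound y p) (hx : IsReal x)
    (hxy : RealLe x y) : UpperBound x p := fun k => by
  refine RatLe.of_forall_twoPow (u' := 3) fun n => ?_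
  have h_k := twoPow_pos k
  have h_kn := twoPow_pos (k + n)
  refine (((hx k n).1.trans (hxy (k + n))).trans (h (k + n))).mono (by positivity) ?_
  rw [twoPow_add]
  set a := M.twoPow k
  set b := M.twoPow n
  calc _ = a ^ 3 * b ^ 2 * (b + 3 * 1) := by ring
    _ ≤ a ^ 3 * b ^ 2 * (b + 3 * a) := by
      have := one_le_twoPow k
      gcongr
    _ = _ := by ring

theorem IsReal.exists_upperBound (hx : IsReal x) (k : M.C o) : ∃ s, UpperBound x s ∧
    ∀ p u w, RatLe p s u w ↔ RatLe p (x k) (u * M.twoPow k + w) (w * M.twoPow k) := by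
  obtain ⟨s, hs⟩ := (hx k 0).1.isRat_left.exists_add_inv (twoPow_pos k)
  refine ⟨s, fun n => (hs _ _ _).2 ?_, hs⟩
  obtain h | h := le_total n k <;> obtain ⟨i, rfl⟩ := exists_add_of_le h
  · refine (hx n i).1.mono (twoPow_pos n) ?_
    rw [add_mul, one_mul, one_mul, mul_comm (M.twoPow n)]
    exact le_self_add
  · refine (hx k i).2.mono (twoPow_pos k) ?_
    rw [add_mul, one_mul, one_mul]
    exact le_add_self

theorem realLe_of_forall_upperBound (hy : IsReal y)
    (h : ∀ p, UpperBound y p → UpperBound x p) : RealLe x y := fun k => by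
  obtain ⟨s, hys, hs⟩ := hy.exists_upperBound k
  refine ((hs _ _ _).1 (h s hys k)).mono (mul_pos (twoPow_pos k) (twoPow_pos k)) (le_of_eq ?_)
  ring

theorem realEq_iff_forall_upperBound (hx : IsReal x) (hy : IsReal y) :
    RealEq x y ↔ ∀ p, UpperBound x p ↔ UpperBound y p :=
  ⟨fun h _ => ⟨fun hp => hp.of_realLe hy h.2, fun hp => hp.of_realLe hx h.1⟩, fun h =>
    ⟨realLe_of_forall_upperBound hy fun p => (h p).2,
      realLe_of_forall_upperBound hx fun p => (h p).1⟩⟩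

end RCA

section ACA

variable [M.IsACA]

theorem injects_real_of_injects_baire (h : Injects (M := M) (σ := t1) (fun _ => True) Eq) :
    Injects (M := M) IsReal RealEq := by
  classical
  let φ : Fml := .all o (ratLeAdd (.var t1 0 ⬝ .var o 0) (.var o 1) .one (.var o 0))
  have hφ : φ.Arith := by simp [φ, ratLeAdd, Fml.Arith, Fml.ex, Fml.neg, Fml.and, Fml.le, Fml.or]
  have hφ_eval (x : M.C t1) (p : M.C o) :
      φ.eval (Env.cons p (Env.cons x default)) ↔ UpperBound x p := by
    simp only [φ, Fml.eval_all, eval_ratLeAdd, Tm.eval, Env.cons_zero,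
      Env.cons_ne (show o ≠ t1 by decide)]
    rfl
  obtain ⟨F, hF⟩ := exists_indicator (M := M) (σ := t1) (τ := o) hφ default
  simp only [hφ_eval] at hF
  refine h.comap F (fun _ _ => trivial) fun x y hx hy => ?_
  rw [realEq_iff_forall_upperBound hx hy]
  refine ⟨fun h => M.ext fun p => by simp only [hF, h p], fun h p => ?_⟩
  have h_one (z : M.C t1) : UpperBound z p ↔ F z p = 1 := by simp [hF]
  rw [h_one, h_one, h]

theorem injects_baire_of_injects_cantor (h : Injects (M := M) IsCantor Eq) :
    Injects (M := M) (σ := t1) (fun _ => True) Eq := by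
  classical
  let φ : Fml := .ex o (.eq (pair (.var o 0) (.var t1 0 ⬝ .var o 0)) (.var o 1))
  have hφ : φ.Arith := by simp [φ, Fml.Arith, Fml.ex, Fml.neg]
  have hφ_eval (f : M.C t1) (p : M.C o) :
      φ.eval (Env.cons p (Env.cons f default)) ↔ ∃ n, natPair n (f n) = p := by
    simp only [φ, Fml.eval_ex, Fml.eval_eq, eval_pair, Tm.eval, Env.cons_zero,
      Env.cons_ne (show o ≠ t1 by decide)]
    rfl
  obtain ⟨F, hF⟩ := exists_indicator (M := M) (σ := t1) (τ := o) hφ default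
  simp only [hφ_eval] at hF
  refine h.comap F (fun f _ p => ?_) fun f g _ _ => ⟨congrArg F, fun h => M.ext fun n => ?_⟩
  · rw [hF]
    split_ifs
    exacts [le_rfl, Model.zero_le 1]
  · have h_graph : F g (natPair n (f n)) = 1 := by rw [← h, hF, if_pos ⟨n, rfl⟩]
    obtain ⟨m, hm⟩ : ∃ m, natPair m (g m) = natPair n (f n) := by simpa [hF] using h_graph
    obtain ⟨rfl, h_apply⟩ := natPair_inj.1 hm
    exact h_apply.symm

variable (M) in
theorem injects_tfae : List.TFAE [Injects (M := M) IsUnitReal RealEq, Injects (M := M) IsCantor Eq,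
    Injects (M := M) (σ := t1) (fun _ => True) Eq, Injects (M := M) IsReal RealEq] := by
  tfae_have 1 → 2 := injects_cantor_of_injects_unit
  tfae_have 2 → 3 := injects_baire_of_injects_cantor
  tfae_have 3 → 4 := injects_real_of_injects_baire
  tfae_have 4 → 1 := injects_unit_of_injects_real
  tfae_finish

theorem eval_NIN_tfae (e : M.Env) :
    List.TFAE [NIN.eval e, NINCantor.eval e, NINBaire.eval e, NINReal.eval e] := by
  rw [NIN, NINCantor, NINBaire, NINReal, eval_noInjection eval_inUnit eval_eqReal,
    eval_noInjection eval_inCantor fun e => eval_eqAt e,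
    eval_noInjection (D' := fun _ => True) (fun _ _ => iff_of_true id trivial)
      fun e => eval_eqAt e,
    eval_noInjection eval_inReal eval_eqReal]
  exact (injects_tfae M).not

end ACA
end Model

end HORM

theorem mainTheorem5 :
    HORM.Proves HORM.ACA0 (HORM.Fml.iff HORM.NIN HORM.NINCantor) ∧
    HORM.Proves HORM.ACA0 (HORM.Fml.iff HORM.NINCantor HORM.NINBaire) ∧
    HORM.Proves HORM.ACA0 (HORM.Fml.iff HORM.NINBaire HORM.NINReal) := by
  open HORM Model in
  have tfae (M : Model) (hM : M.Sat ACA0) (e : M.Env) :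
      List.TFAE [NIN.eval e, NINCantor.eval e, NINBaire.eval e, NINReal.eval e] :=
    have : M.IsACA := ⟨hM⟩
    eval_NIN_tfae e
  refine ⟨ACA0_proves_of_valid fun M hM e => ?_, ACA0_proves_of_valid fun M hM e => ?_,
    ACA0_proves_of_valid fun M hM e => ?_⟩ <;> rw [Fml.eval_iff]
  · exact (tfae M hM e).out 0 1
  · exact (tfae M hM e).out 1 2
  · exact (tfae M hM e).out 2 3
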